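/- Let $V:\mathbb R^2\to\mathbb R$ be measurable and not almost everywhere zero. Assume that $\langle x\rangle^{10+\varepsilon}V\in L^1(\mathbb R^2)$ for some $\varepsilon>0$, where $\langle x\rangle=(1+|x|^2)^{1/2}$, and that for some $q>1$ the function $x\mapsto\big(\int_{|x-y|<1}|V(y)|^q\,dy\big)^{1/q}$ is in $L^1(\mathbb R^2)$. Let $H=\Delta^2+V$ and $$\mathcal N_\infty(H)=\{\varphi\in\langle x\rangle L^\infty(\mathbb R^2)\,:\ (\Delta^2+V)\varphi=0\ \text{in the sense of distributions}\}.$$ $H$ is called regular at zero if $\mathcal N_\infty(H)=\{0\}$, and singular at zero otherwise. Put $v=|V|^{1/2}$, $U=1$ where $V\ge 0$ and $U=-1$ where $V<0$; $M_F$ denotes multiplication by $F$. Let $$G_{2,l}u(x)=\frac1{8\pi}\int_{\mathbb R^2}|x-y|^2\log|x-y|\,u(y)\,dy,\qquad G_{2,l}^{(v)}=M_vG_{2,l}M_v,\qquad T_0=M_U+G_{2,l}^{(v)}\ \text{ on } L^2(\mathbb R^2),$$ and let $S_0$ be the orthogonal projection of $L^2(\mathbb R^2)$ (complex-valued functions)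 onto $\{u\in L^2(\mathbb R^2):\ \langle x^\alpha v,u\rangle=0,\ |\alpha|\le 1\}$. **Proposition.** (1) $H$ is regular at zero if and only if $S_0T_0S_0$, as a bounded operator on the Hilbert space $S_0L^2$, is invertible. (2) Suppose that $H$ is singular at zero. For each $f\in\ker\big(S_0T_0S_0|_{S_0L^2}\big)$ there is a unique $(c_0,c_1,c_2)\in\mathbb C^3$ with $$T_0f=(c_0+c_1x_1+c_2x_2)\,v .$$ With these coefficients, the map $$\Phi(f)(x)=G_{2,l}(vf)(x)-(c_0+c_1x_1+c_2x_2)$$ is a linear isomorphism from $\ker\big(S_0T_0S_0|_{S_0L^2}\big)$ onto $\mathcal N_\infty(H)$, and its inverse is $\varphi\mapsto -M_UM_v\varphi=-Uv\varphi$. -/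

import Mathlib

open MeasureTheory
open scoped ENNReal
open scoped ContDiff

noncomputable section

namespace ZeroResonance

/-- The plane `ℝ²` with its Euclidean norm. -/
abbrev Plane : Type := EuclideanSpace ℝ (Fin 2)

/-- The Hilbert space `L²(ℝ²)` of complex functions. -/
abbrev L2 : Type := Lp ℂ 2 (volume : Measure Plane)

/-- The weight `⟨x⟩ = (1 + |x|²)^{1/2}`. -/
def jap (x : Plane) : ℝ := Real.sqrt (1 + ‖x‖ ^ 2)

/-- The class of real potentials: for some `q > 1` the function
`N_q(V)(x) = (∫_{|x-y|<1} |V(y)|^q dy)^{1/q}` is integrable, and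
`⟨x⟩^{10+ε} V ∈ L¹` for some `ε > 0`. -/
structure Admissible (V : Plane → ℝ) : Prop where
  local_cond : ∃ q : ℝ, 1 < q ∧
    (∫⁻ x : Plane, (∫⁻ y in Metric.ball x 1, ‖V y‖ₑ ^ q) ^ (1 / q)) < (⊤ : ℝ≥0∞)
  decay_cond : ∃ ε : ℝ, 0 < ε ∧ Integrable (fun x : Plane => jap x ^ (10 + ε) * V x)

/-- `U = sign V`, with the value `1` where `V = 0`. -/
def sgn (V : Plane → ℝ) (x : Plane) : ℝ := if 0 ≤ V x then 1 else -1

/-- `v = |V|^{1/2}`. -/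
def rt (V : Plane → ℝ) (x : Plane) : ℝ := Real.sqrt |V x|

/-- The monomials `x^α`, `|α| ≤ 1`: that is `1`, `x₁`, `x₂`. -/
def mono : Fin 3 → Plane → ℝ := ![fun _ => 1, fun x => x 0, fun x => x 1]

/-- The convolution kernel `|x|² log |x| / (8π)` of `G_{2,l}`. -/
def kerG (x : Plane) : ℝ := ‖x‖ ^ 2 * Real.log ‖x‖ / (8 * Real.pi)

/-- The convolution operator `(G_{2,l} u)(x) = ∫ |x-y|² log|x-y| u(y) dy / (8π)`. -/
def convG (u : Plane → ℂ) (x : Plane) : ℂ := ∫ y : Plane, (kerG (x - y) : ℂ) * u y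

/-! ### The space of zero energy resonances -/

lemma locInt_of_bound {φ : Plane →ₘ[volume] ℂ} {C : ℝ}
    (h : ∀ᵐ x : Plane, ‖φ x‖ ≤ C * jap x) : LocallyIntegrable (φ : Plane → ℂ) := by
  have hc : Continuous (fun x : Plane => C * jap x) := by unfold jap; fun_prop
  refine hc.locallyIntegrable.mono φ.aestronglyMeasurable ?_
  filter_upwards [h] with x hx
  exact hx.trans (le_abs_self _)

lemma contDiff_lap {ψ : Plane → ℂ} (h : ContDiff ℝ ∞ ψ) :
    ContDiff ℝ ∞ (Laplacian.laplacian ψ) := by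
  rw [InnerProductSpace.laplacian_eq_iteratedFDeriv_stdOrthonormalBasis]
  refine ContDiff.sum fun i _ => ?_
  have h2 : ContDiff ℝ ∞ (iteratedFDeriv ℝ 2 ψ) :=
    h.iteratedFDeriv_right (by norm_cast)
  exact (ContinuousMultilinearMap.apply ℝ (fun _ : Fin 2 => Plane) ℂ
    ![stdOrthonormalBasis ℝ Plane i, stdOrthonormalBasis ℝ Plane i]).contDiff.comp h2

lemma hasCompactSupport_lap {ψ : Plane → ℂ} (h : HasCompactSupport ψ) :
    HasCompactSupport (Laplacian.laplacian ψ) := by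
  rw [InnerProductSpace.laplacian_eq_iteratedFDeriv_stdOrthonormalBasis]
  refine (h.iteratedFDeriv (𝕜 := ℝ) 2).mono ?_
  intro x hx hx'
  apply hx
  simp [hx']

/-- The space of zero energy resonances: all `φ ∈ ⟨x⟩ L^∞(ℝ²)` that solve
`(Δ² + V) φ = 0` in the sense of distributions. -/
def resonanceSpace (V : Plane → ℝ) : Submodule ℂ (Plane →ₘ[volume] ℂ) where
  carrier := {φ | (∃ C : ℝ, ∀ᵐ x : Plane, ‖φ x‖ ≤ C * jap x) ∧
    LocallyIntegrable (fun x : Plane => (V x : ℂ) * φ x) ∧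
    ∀ ψ : Plane → ℂ, ContDiff ℝ ∞ ψ → HasCompactSupport ψ →
      (∫ x : Plane, φ x * Laplacian.laplacian (Laplacian.laplacian ψ) x)
        + (∫ x : Plane, (V x : ℂ) * φ x * ψ x) = 0}
  zero_mem' := by
    have h0 : ((0 : Plane →ₘ[volume] ℂ) : Plane → ℂ) =ᵐ[volume] 0 := AEEqFun.coeFn_zero
    refine ⟨⟨0, ?_⟩, ?_, ?_⟩
    · filter_upwards [h0] with x hx
      simp [hx]
    · refine (locallyIntegrable_zero (X := Plane) (ε'' := ℂ)).congr ?_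
      filter_upwards [h0] with x hx
      simp [hx]
    · intro ψ _ _
      rw [integral_eq_zero_of_ae, integral_eq_zero_of_ae, add_zero]
      · filter_upwards [h0] with x hx
        simp [hx]
      · filter_upwards [h0] with x hx
        simp [hx]
  add_mem' := by
    rintro φ χ ⟨⟨C, hC⟩, hl, he⟩ ⟨⟨D, hD⟩, hm, hf⟩
    have ha := AEEqFun.coeFn_add φ χ
    refine ⟨⟨C + D, ?_⟩, ?_, ?_⟩
    · filter_upwards [ha, hC, hD] with x hx h1 h2
      rw [hx, Pi.add_apply, add_mul]
      exact (norm_add_le _ _).trans (add_le_add h1 h2)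
    · refine (hl.add hm).congr ?_
      filter_upwards [ha] with x hx
      simp [hx, mul_add]
    · intro ψ h1 h2
      have c2 := (contDiff_lap (contDiff_lap h1)).continuous
      have s2 := hasCompactSupport_lap (hasCompactSupport_lap h2)
      have i1 : Integrable (fun x : Plane =>
          φ x * Laplacian.laplacian (Laplacian.laplacian ψ) x) := (locInt_of_bound hC).integrable_smul_right_of_hasCompactSupport c2 s2
      have i2 : Integrable (fun x : Plane =>
          χ x * Laplacian.laplacian (Laplacian.laplacian ψ) x) := (locInt_of_bound hD).integrable_smul_right_of_hasCompactSupport c2 s2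
      have i3 : Integrable (fun x : Plane => (V x : ℂ) * φ x * ψ x) :=
        hl.integrable_smul_right_of_hasCompactSupport h1.continuous h2
      have i4 : Integrable (fun x : Plane => (V x : ℂ) * χ x * ψ x) :=
        hm.integrable_smul_right_of_hasCompactSupport h1.continuous h2
      have e1 : (∫ x : Plane, (φ + χ) x * Laplacian.laplacian (Laplacian.laplacian ψ) x) =
          (∫ x : Plane, φ x * Laplacian.laplacian (Laplacian.laplacian ψ) x)
          + ∫ x : Plane, χ x * Laplacian.laplacian (Laplacian.laplacian ψ) x := by
        rw [← integral_add i1 i2]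
        refine integral_congr_ae ?_
        filter_upwards [ha] with x hx
        simp [hx, add_mul]
      have e2 : (∫ x : Plane, (V x : ℂ) * (φ + χ) x * ψ x) =
          (∫ x : Plane, (V x : ℂ) * φ x * ψ x) + ∫ x : Plane, (V x : ℂ) * χ x * ψ x := by
        rw [← integral_add i3 i4]
        refine integral_congr_ae ?_
        filter_upwards [ha] with x hx
        simp [hx, add_mul, mul_add]
      rw [e1, e2]
      linear_combination he ψ h1 h2 + hf ψ h1 h2
  smul_mem' := by
    rintro c φ ⟨⟨C, hC⟩, hl, he⟩
    have ha := AEEqFun.coeFn_smul c φ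
    refine ⟨⟨‖c‖ * C, ?_⟩, ?_, ?_⟩
    · filter_upwards [ha, hC] with x hx h1
      rw [hx, Pi.smul_apply, norm_smul, mul_assoc]
      exact mul_le_mul_of_nonneg_left h1 (norm_nonneg _)
    · refine (hl.smul c).congr ?_
      filter_upwards [ha] with x hx
      simp only [hx, Pi.smul_apply, smul_eq_mul]
      ring
    · intro ψ h1 h2
      have e1 : (∫ x : Plane, (c • φ) x * Laplacian.laplacian (Laplacian.laplacian ψ) x) =
          c * (∫ x : Plane, φ x * Laplacian.laplacian (Laplacian.laplacian ψ) x) := by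
        rw [← integral_const_mul]
        refine integral_congr_ae ?_
        filter_upwards [ha] with x hx
        simp only [hx, Pi.smul_apply, smul_eq_mul]
        ring
      have e2 : (∫ x : Plane, (V x : ℂ) * (c • φ) x * ψ x) =
          c * (∫ x : Plane, (V x : ℂ) * φ x * ψ x) := by
        rw [← integral_const_mul]
        refine integral_congr_ae ?_
        filter_upwards [ha] with x hx
        simp only [hx, Pi.smul_apply, smul_eq_mul]
        ring
      rw [e1, e2, ← mul_add, he ψ h1 h2, mul_zero]

/-- `H = Δ² + V` is regular at zero if it has no nontrivial zero energy resonance;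
otherwise it is singular at zero. -/
def IsRegularAtZero (V : Plane → ℝ) : Prop := resonanceSpace V = ⊥

/-! ### Facts that make the operators well defined -/

variable {V : Plane → ℝ}

lemma one_le_jap (x : Plane) : 1 ≤ jap x :=
  Real.one_le_sqrt.2 (by nlinarith [sq_nonneg ‖x‖])

lemma one_add_norm_le (x : Plane) : 1 + ‖x‖ ≤ 2 * jap x := by
  have h : ‖x‖ ≤ jap x := Real.le_sqrt_of_sq_le (by linarith)
  linarith [one_le_jap x]

lemma continuous_jap : Continuous jap := by unfold jap; fun_prop

lemma Admissible.aesm (hV : Admissible V) : AEStronglyMeasurable V volume := by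
  obtain ⟨ε, _, h⟩ := hV.decay_cond
  have hm : AEStronglyMeasurable (fun x : Plane => (jap x ^ (10 + ε))⁻¹) volume :=
    ((continuous_jap.measurable.pow_const _).inv).aestronglyMeasurable
  refine (hm.mul h.aestronglyMeasurable).congr (Filter.Eventually.of_forall fun x => ?_)
  have : jap x ^ (10 + ε) ≠ 0 := (Real.rpow_pos_of_pos (by linarith [one_le_jap x]) _).ne'
  simp only [Pi.mul_apply]
  field_simp

lemma Admissible.aesm_rt (hV : Admissible V) : AEStronglyMeasurable (rt V) volume :=
  (Real.continuous_sqrt.comp continuous_abs).comp_aestronglyMeasurable hV.aesm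

lemma Admissible.aesm_sgn (hV : Admissible V) : AEStronglyMeasurable (sgn V) volume := by
  have hm : Measurable (fun t : ℝ => if 0 ≤ t then (1 : ℝ) else -1) :=
    Measurable.ite measurableSet_Ici measurable_const measurable_const
  exact (hm.comp_aemeasurable hV.aesm.aemeasurable).aestronglyMeasurable

/-- The dominating weight `(1 + |x|)³ v(x)`. -/
def wt (V : Plane → ℝ) (x : Plane) : ℝ := (1 + ‖x‖) ^ 3 * rt V x

lemma rt_nonneg (x : Plane) : 0 ≤ rt V x := Real.sqrt_nonneg _

lemma wt_nonneg (x : Plane) : 0 ≤ wt V x :=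
  mul_nonneg (by positivity) (rt_nonneg x)

lemma Admissible.memLp_wt (hV : Admissible V) : MemLp (wt V) 2 := by
  have hm : AEStronglyMeasurable (wt V) volume :=
    (Continuous.aestronglyMeasurable (by fun_prop)).mul hV.aesm_rt
  rw [memLp_two_iff_integrable_sq hm]
  obtain ⟨ε, hε, h⟩ := hV.decay_cond
  refine (h.norm.const_mul 64).mono' (hm.pow 2) (Filter.Eventually.of_forall fun x => ?_)
  have h1 := one_le_jap x
  have h2 : (1 + ‖x‖) ^ 6 ≤ 64 * jap x ^ (10 + ε) := by
    calc (1 + ‖x‖) ^ 6 ≤ (2 * jap x) ^ 6 :=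
          pow_le_pow_left₀ (by positivity) (one_add_norm_le x) 6
      _ = 64 * jap x ^ (6 : ℝ) := by
          rw [mul_pow]
          norm_num
      _ ≤ 64 * jap x ^ (10 + ε) := by
          gcongr
          linarith
  have h3 : rt V x ^ 2 = |V x| := Real.sq_sqrt (abs_nonneg _)
  have h4 : 0 ≤ jap x ^ (10 + ε) := Real.rpow_nonneg (by linarith) _
  have h5 : wt V x ^ 2 = (1 + ‖x‖) ^ 6 * |V x| := by
    rw [wt, mul_pow, h3]
    ring
  rw [h5, Real.norm_of_nonneg (by positivity), norm_mul, Real.norm_of_nonneg h4,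
    Real.norm_eq_abs, ← mul_assoc]
  exact mul_le_mul_of_nonneg_right h2 (abs_nonneg _)

lemma abs_kerG_le (x y : Plane) : |kerG (x - y)| ≤ (1 + ‖x‖) ^ 3 * (1 + ‖y‖) ^ 3 := by
  have key : ∀ t : ℝ, 0 ≤ t → |t ^ 2 * Real.log t| ≤ (1 + t) ^ 3 := by
    intro t ht
    rw [abs_mul, abs_of_nonneg (sq_nonneg t)]
    rcases ht.eq_or_lt with h0 | h0
    · subst h0
      simp
    rcases le_total t 1 with h1 | h1
    · have := Real.abs_log_mul_self_lt t h0 h1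
      rw [abs_mul, abs_of_pos h0] at this
      have h2 : t ^ 2 * |Real.log t| = t * (|Real.log t| * t) := by ring
      rw [h2]
      have : t * (|Real.log t| * t) ≤ 1 * 1 := by
        gcongr
      nlinarith [pow_nonneg ht 2, pow_nonneg ht 3]
    · rw [abs_of_nonneg (Real.log_nonneg h1)]
      have := Real.log_le_sub_one_of_pos h0
      have : t ^ 2 * Real.log t ≤ t ^ 2 * t := by
        gcongr
        linarith
      nlinarith [pow_nonneg ht 2, pow_nonneg ht 3]
  have hpi : (1 : ℝ) ≤ 8 * Real.pi := by linarith [Real.pi_gt_three]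
  have h1 : ‖x - y‖ ≤ ‖x‖ + ‖y‖ := norm_sub_le _ _
  calc |kerG (x - y)| ≤ |‖x - y‖ ^ 2 * Real.log ‖x - y‖| := by
        rw [kerG, abs_div, abs_of_pos (by linarith : (0 : ℝ) < 8 * Real.pi)]
        exact div_le_self (abs_nonneg _) hpi
    _ ≤ (1 + ‖x - y‖) ^ 3 := key _ (norm_nonneg _)
    _ ≤ ((1 + ‖x‖) * (1 + ‖y‖)) ^ 3 := by
        refine pow_le_pow_left₀ (by positivity) ?_ 3
        nlinarith [norm_nonneg x, norm_nonneg y]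
    _ = _ := mul_pow _ _ _

lemma measurable_kerG : Measurable kerG := by
  unfold kerG
  fun_prop

/-- For `f ∈ L²` the integral defining `G_{2,l} M_v f` converges absolutely at every point. -/
lemma Admissible.integrable_kerG (hV : Admissible V) (f : L2) (x : Plane) :
    Integrable (fun y : Plane => (kerG (x - y) : ℂ) * ((rt V y : ℂ) * f y)) := by
  have hi : Integrable (fun y : Plane => wt V y * ‖f y‖) :=
    hV.memLp_wt.integrable_mul (Lp.memLp f).norm
  refine (hi.const_mul ((1 + ‖x‖) ^ 3)).mono' ?_ (Filter.Eventually.of_forall fun y => ?_)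
  · refine AEStronglyMeasurable.mul ?_ (AEStronglyMeasurable.mul ?_ ?_)
    · exact (Complex.measurable_ofReal.comp
        (measurable_kerG.comp (measurable_const.sub measurable_id))).aestronglyMeasurable
    · exact Complex.continuous_ofReal.comp_aestronglyMeasurable hV.aesm_rt
    · exact Lp.aestronglyMeasurable f
  · rw [norm_mul, norm_mul, Complex.norm_real, Complex.norm_real, Real.norm_eq_abs,
      Real.norm_of_nonneg (rt_nonneg y), wt]
    have := abs_kerG_le x y
    have h2 : 0 ≤ rt V y * ‖f y‖ := mul_nonneg (rt_nonneg y) (norm_nonneg _)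
    calc |kerG (x - y)| * (rt V y * ‖f y‖)
        ≤ ((1 + ‖x‖) ^ 3 * (1 + ‖y‖) ^ 3) * (rt V y * ‖f y‖) :=
          mul_le_mul_of_nonneg_right this h2
      _ = _ := by ring

/-- The function `v · G_{2,l}(v f)`. -/
def sandwich (V : Plane → ℝ) (f : Plane → ℂ) (x : Plane) : ℂ :=
  (rt V x : ℂ) * convG (fun y => (rt V y : ℂ) * f y) x

lemma Admissible.norm_sandwich_le (hV : Admissible V) (f : L2) (x : Plane) :
    ‖sandwich V f x‖ ≤ ‖hV.memLp_wt.toLp (wt V)‖ * ‖f‖ * wt V x := by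
  have hi : Integrable (fun y : Plane => wt V y * ‖f y‖) :=
    hV.memLp_wt.integrable_mul (Lp.memLp f).norm
  have hcs : ∫ y : Plane, wt V y * ‖f y‖ ≤ ‖hV.memLp_wt.toLp (wt V)‖ * ‖f‖ := by
    have hn : MemLp (fun y : Plane => ‖f y‖) 2 volume := (Lp.memLp f).norm
    have h1 : ∫ y : Plane, wt V y * ‖f y‖ =
        inner ℝ (hn.toLp _) (hV.memLp_wt.toLp (wt V)) := by
      rw [L2.inner_def]
      refine integral_congr_ae ?_
      filter_upwards [hn.coeFn_toLp, hV.memLp_wt.coeFn_toLp] with y h2 h3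
      simp [h2, h3]
    have h2 : ‖hn.toLp _‖ = ‖f‖ := by
      rw [Lp.norm_toLp, Lp.norm_def, eLpNorm_norm]
    rw [h1, mul_comm, ← h2]
    exact real_inner_le_norm _ _
  have hb : ‖convG (fun y => (rt V y : ℂ) * f y) x‖ ≤
      (1 + ‖x‖) ^ 3 * ∫ y : Plane, wt V y * ‖f y‖ := by
    rw [← integral_const_mul]
    refine norm_integral_le_of_norm_le (hi.const_mul _) (Filter.Eventually.of_forall fun y => ?_)
    rw [norm_mul, norm_mul, Complex.norm_real, Complex.norm_real, Real.norm_eq_abs,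
      Real.norm_of_nonneg (rt_nonneg y), wt]
    have h2 : 0 ≤ rt V y * ‖f y‖ := mul_nonneg (rt_nonneg y) (norm_nonneg _)
    calc |kerG (x - y)| * (rt V y * ‖f y‖)
        ≤ ((1 + ‖x‖) ^ 3 * (1 + ‖y‖) ^ 3) * (rt V y * ‖f y‖) :=
          mul_le_mul_of_nonneg_right (abs_kerG_le x y) h2
      _ = _ := by ring
  rw [sandwich, norm_mul, Complex.norm_real, Real.norm_of_nonneg (rt_nonneg x)]
  calc rt V x * ‖convG (fun y => (rt V y : ℂ) * f y) x‖
      ≤ rt V x * ((1 + ‖x‖) ^ 3 * (‖hV.memLp_wt.toLp (wt V)‖ * ‖f‖)) := by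
        refine mul_le_mul_of_nonneg_left (hb.trans ?_) (rt_nonneg x)
        exact mul_le_mul_of_nonneg_left hcs (by positivity)
    _ = _ := by rw [wt]; ring

lemma Admissible.memLp_sandwich (hV : Admissible V) (f : L2) :
    MemLp (sandwich V f) 2 volume := by
  refine hV.memLp_wt.of_le_mul (c := ‖hV.memLp_wt.toLp (wt V)‖ * ‖f‖) ?_
    (Filter.Eventually.of_forall fun x => ?_)
  · refine (Complex.continuous_ofReal.comp_aestronglyMeasurable hV.aesm_rt).mul ?_
    refine AEStronglyMeasurable.integral_prod_right'
      (f := fun p : Plane × Plane => (kerG (p.1 - p.2) : ℂ) * ((rt V p.2 : ℂ) * f p.2)) ?_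
    refine AEStronglyMeasurable.mul ?_ (AEStronglyMeasurable.mul ?_ ?_)
    · exact (Complex.measurable_ofReal.comp
        (measurable_kerG.comp (measurable_fst.sub measurable_snd))).aestronglyMeasurable
    · exact Complex.continuous_ofReal.comp_aestronglyMeasurable hV.aesm_rt.comp_snd
    · exact (Lp.aestronglyMeasurable f).comp_snd
  · rw [Real.norm_of_nonneg (wt_nonneg x)]
    exact hV.norm_sandwich_le f x

lemma Admissible.memLp_sgn_mul (hV : Admissible V) (f : L2) :
    MemLp (fun x : Plane => (sgn V x : ℂ) * f x) 2 volume := by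
  refine (Lp.memLp f).of_le
    ((Complex.continuous_ofReal.comp_aestronglyMeasurable hV.aesm_sgn).mul
      (Lp.aestronglyMeasurable f)) (Filter.Eventually.of_forall fun x => ?_)
  rw [norm_mul, Complex.norm_real]
  have : ‖sgn V x‖ = 1 := by
    unfold sgn
    split_ifs <;> simp
  simp [this]

lemma Admissible.memLp_mono_rt (hV : Admissible V) (i : Fin 3) :
    MemLp (fun x : Plane => ((mono i x * rt V x : ℝ) : ℂ)) 2 volume := by
  have hc : Continuous (mono i) := by
    fin_cases i <;> simp [mono] <;> fun_prop
  refine hV.memLp_wt.of_le (Complex.continuous_ofReal.comp_aestronglyMeasurable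
    (hc.aestronglyMeasurable.mul hV.aesm_rt)) (Filter.Eventually.of_forall fun x => ?_)
  have hb : |mono i x| ≤ (1 + ‖x‖) ^ 3 := by
    have h1 : |mono i x| ≤ 1 + ‖x‖ := by
      have h := fun j => PiLp.norm_apply_le x j
      simp only [Real.norm_eq_abs] at h
      fin_cases i
      · simp [mono]
      · simpa [mono] using (h 0).trans (by linarith)
      · simpa [mono] using (h 1).trans (by linarith)
    nlinarith [norm_nonneg x, pow_nonneg (norm_nonneg x) 2, pow_nonneg (norm_nonneg x) 3]
  rw [Complex.norm_real, norm_mul, Real.norm_of_nonneg (rt_nonneg x),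
    Real.norm_of_nonneg (wt_nonneg x), wt, Real.norm_eq_abs]
  exact mul_le_mul_of_nonneg_right hb (rt_nonneg x)

/-! ### The operators on `L²` -/

/-- Multiplication by `U` on `L²`. -/
def opU (hV : Admissible V) : L2 →L[ℂ] L2 :=
  LinearMap.mkContinuous
    { toFun := fun f => (hV.memLp_sgn_mul f).toLp _
      map_add' := by
        intro f g
        refine Lp.ext ?_
        filter_upwards [(hV.memLp_sgn_mul (f + g)).coeFn_toLp, (hV.memLp_sgn_mul f).coeFn_toLp,
          (hV.memLp_sgn_mul g).coeFn_toLp, Lp.coeFn_add f g,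
          Lp.coeFn_add ((hV.memLp_sgn_mul f).toLp _) ((hV.memLp_sgn_mul g).toLp _)]
          with x h1 h2 h3 h4 h5
        rw [h5, Pi.add_apply, h1, h2, h3, h4, Pi.add_apply, mul_add]
      map_smul' := by
        intro c f
        refine Lp.ext ?_
        filter_upwards [(hV.memLp_sgn_mul (c • f)).coeFn_toLp, (hV.memLp_sgn_mul f).coeFn_toLp,
          Lp.coeFn_smul c f, Lp.coeFn_smul c ((hV.memLp_sgn_mul f).toLp _)] with x h1 h2 h3 h4
        rw [RingHom.id_apply, h4, Pi.smul_apply, h1, h2, h3, Pi.smul_apply, smul_eq_mul,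
          smul_eq_mul]
        ring }
    1 (by
      intro f
      refine Lp.norm_le_mul_norm_of_ae_le_mul ?_
      filter_upwards [(hV.memLp_sgn_mul f).coeFn_toLp] with x h1
      have : ‖sgn V x‖ = 1 := by
        unfold sgn
        split_ifs <;> simp
      simp only [LinearMap.coe_mk, AddHom.coe_mk]
      rw [h1, norm_mul, Complex.norm_real, this])

/-- The operator `G_{2,l}^{(v)} = M_v G_{2,l} M_v` on `L²`. -/
def opG (hV : Admissible V) : L2 →L[ℂ] L2 :=
  LinearMap.mkContinuous
    { toFun := fun f => (hV.memLp_sandwich f).toLp _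
      map_add' := by
        intro f g
        refine Lp.ext ?_
        filter_upwards [(hV.memLp_sandwich (f + g)).coeFn_toLp, (hV.memLp_sandwich f).coeFn_toLp,
          (hV.memLp_sandwich g).coeFn_toLp,
          Lp.coeFn_add ((hV.memLp_sandwich f).toLp _) ((hV.memLp_sandwich g).toLp _)]
          with x h1 h2 h3 h5
        rw [h5, Pi.add_apply, h1, h2, h3, sandwich, sandwich, sandwich, ← mul_add, convG, convG,
          convG, ← integral_add (hV.integrable_kerG f x) (hV.integrable_kerG g x)]
        congr 1
        refine integral_congr_ae ?_
        filter_upwards [Lp.coeFn_add f g] with y hy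
        rw [hy, Pi.add_apply]
        ring
      map_smul' := by
        intro c f
        refine Lp.ext ?_
        filter_upwards [(hV.memLp_sandwich (c • f)).coeFn_toLp, (hV.memLp_sandwich f).coeFn_toLp,
          Lp.coeFn_smul c ((hV.memLp_sandwich f).toLp _)] with x h1 h2 h4
        rw [RingHom.id_apply, h4, Pi.smul_apply, h1, h2, smul_eq_mul, sandwich, sandwich,
          mul_left_comm]
        congr 1
        rw [convG, convG, ← integral_const_mul]
        refine integral_congr_ae ?_
        filter_upwards [Lp.coeFn_smul c f] with y hy
        rw [hy, Pi.smul_apply, smul_eq_mul]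
        ring }
    (‖hV.memLp_wt.toLp (wt V)‖ * ‖hV.memLp_wt.toLp (wt V)‖) (by
      intro f
      rw [mul_right_comm]
      refine Lp.norm_le_mul_norm_of_ae_le_mul ?_
      filter_upwards [(hV.memLp_sandwich f).coeFn_toLp, hV.memLp_wt.coeFn_toLp] with x h1 h2
      simp only [LinearMap.coe_mk, AddHom.coe_mk]
      rw [h1, h2, Real.norm_of_nonneg (wt_nonneg x)]
      exact hV.norm_sandwich_le f x)

/-- `T₀ = M_U + G_{2,l}^{(v)}`. -/
def opT (hV : Admissible V) : L2 →L[ℂ] L2 := opU hV + opG hV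

/-- The functions `x^α v ∈ L²`, `|α| ≤ 1`. -/
def monoV (hV : Admissible V) (i : Fin 3) : L2 := (hV.memLp_mono_rt i).toLp _

/-- The range of `S₀`: the closed subspace `{u ∈ L² : ⟨x^α v, u⟩ = 0, |α| ≤ 1}`. -/
def S0 (hV : Admissible V) : Submodule ℂ L2 := (Submodule.span ℂ (Set.range (monoV hV)))ᗮ

lemma mem_S0_iff (hV : Admissible V) (u : L2) :
    u ∈ S0 hV ↔ ∀ i, inner ℂ (monoV hV i) u = 0 := by
  constructor
  · intro h i
    exact (Submodule.mem_orthogonal _ _).1 h _ (Submodule.subset_span ⟨i, rfl⟩)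
  · intro h
    refine (Submodule.mem_orthogonal _ _).2 fun w hw => ?_
    induction hw using Submodule.span_induction with
    | mem w hw =>
      obtain ⟨i, rfl⟩ := hw
      exact h i
    | zero => simp
    | add a b _ _ ha hb => rw [inner_add_left, ha, hb, add_zero]
    | smul c a _ ha => rw [inner_smul_left, ha, mul_zero]

instance (hV : Admissible V) : (S0 hV).HasOrthogonalProjection := by
  unfold S0
  infer_instance

/-- `S₀ T₀ S₀` as an operator on the Hilbert space `S₀ L²`. -/
def compT (hV : Admissible V) : S0 hV →L[ℂ] S0 hV :=
  (S0 hV).orthogonalProjectionOnto ∘L opT hV ∘L (S0 hV).subtypeL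

end ZeroResonance

end

open ZeroResonance

/-!
Write `G u` for `G_{2,l} u`, and `u = v f` for `f ∈ L²`; the decay of `V` gives
`(1 + |x|)⁴ u ∈ L¹`. The correspondence between `ker (S₀ T₀ S₀)` and the resonances rests on three
facts about the bilaplacian in the plane.

* `G` inverts the bilaplacian: `Δ² (G u) = u` in the sense of distributions
  (`integral_convG_mul_bilaplacian`). This follows from `integral_kerG_mul_bilaplacian`, proved by
  regularising `|x|² log |x|` to a function of `|x|² + ε` whose bilaplacian is an explicit
  approximate identity.
* A distributional solution of `Δ² φ = u` of linear growth is `G u` plus an affine function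
  (`exists_ae_eq_convG_add`). Tested against a function `ψ` whose moments of order at most one
  vanish, the equation for `φ` is applied to the convolution of `ψ` with the kernel cut off at scale
  `R`. The cut-off creates a smooth error at scale `R`, which the moments of `ψ` reduce to size
  `R⁻⁴ log R`; against a function of linear growth on a disc of radius `R` this tends to zero. So
  `φ - G u` annihilates all such `ψ`, and is therefore affine.
* `8π G u (x) = log |x| (m₀ |x|² - 2 m · x) + O(|x|)` with the moments `m₀ = ∫ u` and
  `m = ∫ y u(y) dy` (`norm_convG_sub_le`). Hence, up to affine functions, `G u` has linear growth
  exactly if these moments vanish, that is, if `f` lies in the range of `S₀`.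

If `T₀ f` is an affine function times `v` and `f ∈ S₀ L²`, subtracting this affine function from
`G (v f)` gives `φ` with `v φ = -U f`, so `V φ = -v f = -Δ² φ` and `φ` is a resonance
(`mk_resonance_mem`). Conversely a resonance `φ` gives `f = -U v φ`, and the last two facts show
`f ∈ S₀ L²` and `φ = G (v f)` minus an affine function, whence `T₀ f` is that affine function times
`v` (`exists_resonance_representation`). Since `V` is not almost everywhere zero, `v`, `x₁ v` and
`x₂ v` are linearly independent, and the two maps are inverse to each other.

In particular `H` is regular at zero if and only if `S₀ T₀ S₀` is injective on `S₀ L²`. This is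
equivalent to invertibility by the Fredholm alternative: `M_v G M_v` is compact
(`isCompactOperator_opG`), `M_U` is an involution and `1 - S₀` has finite rank, so
`S₀ T₀ S₀ + (1 - S₀)` is a compact perturbation of `M_U` (`isUnit_compT_iff`).
-/

namespace ZeroResonance
open InnerProductSpace Filter Topology

/-! ### The Laplacian in the plane -/

/-- The standard orthonormal frame of the plane. -/
noncomputable abbrev frame : OrthonormalBasis (Fin 2) ℝ Plane := EuclideanSpace.basisFun (Fin 2) ℝ

lemma laplacian_eq_sum_fderiv {f : Plane → ℂ} {x : Plane}
    (h : DifferentiableAt ℝ (fderiv ℝ f) x) :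
    Laplacian.laplacian f x =
      ∑ i, fderiv ℝ (fun y => fderiv ℝ f y (frame i)) x (frame i) := by
  rw [laplacian_eq_iteratedFDeriv_orthonormalBasis f frame]
  refine Finset.sum_congr rfl fun i _ => ?_
  rw [iteratedFDeriv_two_apply]
  simp only [Matrix.cons_val_zero, Matrix.cons_val_one]
  rw [fderiv_clm_apply h (differentiableAt_const _)]
  simp

lemma differentiableAt_fderiv {f : Plane → ℂ} {x : Plane} (h : ContDiffAt ℝ 2 f x) :
    DifferentiableAt ℝ (fderiv ℝ f) x :=
  (h.fderiv_right (m := 1) (by norm_num)).differentiableAt (by norm_num)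

lemma contDiff_fderiv_apply {f : Plane → ℂ} (h : ContDiff ℝ ∞ f) (v : Plane) :
    ContDiff ℝ ∞ (fun y => fderiv ℝ f y v) :=
  (h.fderiv_right (m := ∞) (by norm_cast)).clm_apply contDiff_const

lemma laplacian_eq_sum {f : Plane → ℂ} (h : ContDiff ℝ ∞ f) (x : Plane) :
    Laplacian.laplacian f x =
      ∑ i, fderiv ℝ (fun y => fderiv ℝ f y (frame i)) x (frame i) :=
  laplacian_eq_sum_fderiv (differentiableAt_fderiv (h.contDiffAt.of_le (by norm_cast)))

lemma laplacian_comp_smul {f : Plane → ℂ} (h : ContDiff ℝ ∞ f) (a : ℝ) (x : Plane) :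
    Laplacian.laplacian (fun y => f (a • y)) x = (a : ℂ) ^ 2 * Laplacian.laplacian f (a • x) := by
  have hs : ContDiff ℝ ∞ (fun y => f (a • y)) := h.comp (contDiff_const_smul a)
  rw [laplacian_eq_sum hs, laplacian_eq_sum h, Finset.mul_sum]
  refine Finset.sum_congr rfl fun i _ => ?_
  have h1 : (fun y => fderiv ℝ (fun y => f (a • y)) y (frame i)) =
      fun y => a • (fun z => fderiv ℝ f z (frame i)) (a • y) := by
    funext y
    rw [fderiv_comp_smul]
    rfl
  have h2 := fderiv_comp_smul (x := x) (f := fun z => fderiv ℝ f z (frame i)) a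
  rw [h1, fderiv_fun_const_smul, h2]
  · simp only [smul_apply, Complex.real_smul]
    ring
  · exact (((contDiff_fderiv_apply h (frame i)).comp (contDiff_const_smul a)).differentiable
      (by norm_num)) x

lemma bilaplacian_comp_smul {f : Plane → ℂ} (h : ContDiff ℝ ∞ f) (a : ℝ) (x : Plane) :
    Laplacian.laplacian (Laplacian.laplacian (fun y => f (a • y))) x =
      (a : ℂ) ^ 4 * Laplacian.laplacian (Laplacian.laplacian f) (a • x) := by
  have h1 : Laplacian.laplacian (fun y => f (a • y)) =
      ((a : ℂ) ^ 2) • fun y => Laplacian.laplacian f (a • y) := by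
    funext y
    exact laplacian_comp_smul h a y
  have h2 : ContDiff ℝ ∞ (fun y => Laplacian.laplacian f (a • y)) :=
    (contDiff_lap h).comp (contDiff_const_smul a)
  have h3 : ((a : ℂ) ^ 2) • (fun y => Laplacian.laplacian f (a • y)) =
      (a ^ 2) • fun y => Laplacian.laplacian f (a • y) := by
    funext y
    simp [Complex.real_smul]
  rw [h1, h3, laplacian_smul _ (h2.contDiffAt.of_le (by norm_cast)),
    laplacian_comp_smul (contDiff_lap h)]
  rw [Complex.real_smul]
  push_cast
  ring

lemma fderiv_comp_const_sub_apply {f : Plane → ℂ} {c x : Plane}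
    (h : DifferentiableAt ℝ f (c - x)) (v : Plane) :
    fderiv ℝ (fun y => f (c - y)) x v = - fderiv ℝ f (c - x) v := by
  have := (h.hasFDerivAt.comp x ((hasFDerivAt_id x).const_sub c)).fderiv
  rw [show (fun y => f (c - y)) = f ∘ HSub.hSub c from rfl, this]
  simp

lemma laplacian_comp_const_sub {f : Plane → ℂ} (h : ContDiff ℝ ∞ f) (c x : Plane) :
    Laplacian.laplacian (fun y => f (c - y)) x = Laplacian.laplacian f (c - x) := by
  have hs : ContDiff ℝ ∞ (fun y => f (c - y)) := h.comp (contDiff_const.sub contDiff_id)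
  rw [laplacian_eq_sum hs, laplacian_eq_sum h]
  refine Finset.sum_congr rfl fun i _ => ?_
  have h1 : (fun y => fderiv ℝ (fun y => f (c - y)) y (frame i)) =
      fun y => - (fun z => fderiv ℝ f z (frame i)) (c - y) := by
    funext y
    exact fderiv_comp_const_sub_apply (h.differentiable (by norm_num) _) _
  have h2 := fderiv_comp_const_sub_apply (c := c) (x := x)
    ((contDiff_fderiv_apply h (frame i)).differentiable (by norm_num) _) (frame i)
  rw [h1, fderiv_fun_neg, neg_apply, h2, neg_neg]

/-- The Laplacian of a radial function in the plane, in the variable `ρ = |x|²`: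
`Δ (g(|x|²)) = 4 (ρ g''(ρ) + g'(ρ))`. -/
lemma laplacian_radial {g g' : ℝ → ℂ} {g'' : ℂ} {x : Plane}
    (h1 : ∀ᶠ r in 𝓝 (‖x‖ ^ 2), HasDerivAt g (g' r) r) (h2 : HasDerivAt g' g'' (‖x‖ ^ 2)) :
    Laplacian.laplacian (fun y : Plane => g (‖y‖ ^ 2)) x =
      4 * ((‖x‖ ^ 2 : ℝ) * g'' + g' (‖x‖ ^ 2)) := by
  have hn : ∀ y : Plane, HasFDerivAt (fun y : Plane => ‖y‖ ^ 2) (2 • innerSL ℝ y) y :=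
    fun y => (hasStrictFDerivAt_norm_sq y).hasFDerivAt
  have hc : Tendsto (fun y : Plane => ‖y‖ ^ 2) (𝓝 x) (𝓝 (‖x‖ ^ 2)) :=
    (hn x).continuousAt
  have hd : fderiv ℝ (fun y : Plane => g (‖y‖ ^ 2)) =ᶠ[𝓝 x]
      fun y => (2 • innerSL ℝ y).smulRight (g' (‖y‖ ^ 2)) := by
    filter_upwards [hc.eventually h1] with y hy
    refine HasFDerivAt.fderiv ?_
    exact (hy.hasFDerivAt.comp y (hn y)).congr_fderiv (by ext; simp [mul_assoc])
  have hl : ∀ i : Fin 2, HasFDerivAt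
      (fun y : Plane => (((2 : ℝ) * inner ℝ y (frame i) : ℝ) : ℂ) * g' (‖y‖ ^ 2))
      ((((2 : ℝ) * inner ℝ x (frame i) : ℝ) : ℂ) •
          (2 • innerSL ℝ x).smulRight g'' +
        (g' (‖x‖ ^ 2)) • (Complex.ofRealCLM.comp ((2 : ℝ) • (innerSL ℝ (frame i))))) x := by
    intro i
    refine HasFDerivAt.mul ?_ ?_
    · refine (Complex.ofRealCLM.hasFDerivAt.comp x
        (f := fun y : Plane => (2 : ℝ) * inner ℝ y (frame i)) ?_)
      have := ((innerSL ℝ (frame i)).hasFDerivAt (x := x)).const_mul (2 : ℝ)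
      refine this.congr_of_eventuallyEq (Eventually.of_forall fun y => ?_)
      simp [real_inner_comm]
    · exact (h2.hasFDerivAt.comp x (hn x)).congr_fderiv (by ext; simp [mul_assoc])
  have hdiff : DifferentiableAt ℝ (fderiv ℝ (fun y : Plane => g (‖y‖ ^ 2))) x := by
    refine DifferentiableAt.congr_of_eventuallyEq ?_ hd
    have e1 : DifferentiableAt ℝ (fun y : Plane => (2 • innerSL ℝ y : Plane →L[ℝ] ℝ)) x := by
      have := ((contDiff_norm_sq ℝ (E := Plane) (n := 2)).fderiv_right (m := 1)
        (by norm_num)).differentiable (by norm_num) x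
      rwa [fderiv_norm_sq] at this
    have e2 : DifferentiableAt ℝ (fun y : Plane => g' (‖y‖ ^ 2)) x :=
      (h2.hasFDerivAt.comp x (hn x)).differentiableAt
    exact (isBoundedBilinearMap_smulRight.differentiableAt
      (2 • innerSL ℝ x, g' (‖x‖ ^ 2))).comp x (e1.prodMk e2)
  rw [laplacian_eq_sum_fderiv hdiff]
  have key : ∀ i, fderiv ℝ (fun y => fderiv ℝ (fun y : Plane => g (‖y‖ ^ 2)) y (frame i)) x
      (frame i) = 4 * (((x i) ^ 2 : ℝ) : ℂ) * g'' + 2 * g' (‖x‖ ^ 2) := by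
    intro i
    have h3 : (fun y => fderiv ℝ (fun y : Plane => g (‖y‖ ^ 2)) y (frame i)) =ᶠ[𝓝 x]
        (fun y : Plane => (((2 : ℝ) * inner ℝ y (frame i) : ℝ) : ℂ) * g' (‖y‖ ^ 2)) := by
      filter_upwards [hd] with y hy
      rw [hy]
      simp
    rw [h3.fderiv_eq, (hl i).fderiv]
    have h4 : inner ℝ x (EuclideanSpace.single i (1 : ℝ)) = x i := by
      simp [EuclideanSpace.inner_single_right]
    simp [h4]
    ring
  rw [Finset.sum_congr rfl fun i _ => key i, EuclideanSpace.norm_sq_eq]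
  simp only [Fin.sum_univ_two, Real.norm_eq_abs, sq_abs]
  push_cast
  ring

/-! ### Integration by parts -/

lemma integral_mul_laplacian {f g : Plane → ℂ} (hf : ContDiff ℝ ∞ f) (hg : ContDiff ℝ ∞ g)
    (hc : HasCompactSupport g) :
    ∫ x, f x * Laplacian.laplacian g x = ∫ x, Laplacian.laplacian f x * g x := by
  have one : ∀ {a b : Plane → ℂ}, ContDiff ℝ ∞ a → ContDiff ℝ ∞ b → HasCompactSupport b →
      ∀ v : Plane, Integrable (fun x => a x * fderiv ℝ b x v) ∧
        Integrable (fun x => fderiv ℝ a x v * b x) ∧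
        ∫ x, a x * fderiv ℝ b x v = - ∫ x, fderiv ℝ a x v * b x := by
    intro a b ha hb hbc v
    have hb' : HasCompactSupport (fun x => fderiv ℝ b x v) := hbc.fderiv_apply (𝕜 := ℝ) v
    have i1 : Integrable (fun x => a x * fderiv ℝ b x v) :=
      (ha.continuous.mul (contDiff_fderiv_apply hb v).continuous).integrable_of_hasCompactSupport
        hb'.mul_left
    have i2 : Integrable (fun x => fderiv ℝ a x v * b x) :=
      ((contDiff_fderiv_apply ha v).continuous.mul hb.continuous).integrable_of_hasCompactSupport
        hbc.mul_left
    have i3 : Integrable (fun x => a x * b x) :=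
      (ha.continuous.mul hb.continuous).integrable_of_hasCompactSupport hbc.mul_left
    refine ⟨i1, i2, ?_⟩
    exact integral_mul_fderiv_eq_neg_fderiv_mul_of_integrable i2 i1 i3
      (fun x _ => ha.differentiable (by norm_num) x)
      (fun x _ => hb.differentiable (by norm_num) x)
  simp only [laplacian_eq_sum hf, laplacian_eq_sum hg, Finset.mul_sum, Finset.sum_mul]
  have p : ∀ i, _ := fun i => one hf (contDiff_fderiv_apply hg (frame i))
    (hc.fderiv_apply (𝕜 := ℝ) (frame i)) (frame i)
  have q : ∀ i, _ := fun i => one (contDiff_fderiv_apply hf (frame i)) hg hc (frame i)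
  rw [integral_finsetSum _ fun i _ => (p i).1, integral_finsetSum _ fun i _ => (q i).2.1]
  refine Finset.sum_congr rfl fun i _ => ?_
  rw [(p i).2.2, (q i).2.2, neg_neg]

lemma integral_mul_bilaplacian {f g : Plane → ℂ} (hf : ContDiff ℝ ∞ f) (hg : ContDiff ℝ ∞ g)
    (hc : HasCompactSupport g) :
    ∫ x, f x * Laplacian.laplacian (Laplacian.laplacian g) x =
      ∫ x, Laplacian.laplacian (Laplacian.laplacian f) x * g x := by
  rw [integral_mul_laplacian hf (contDiff_lap hg) (hasCompactSupport_lap hc),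
    integral_mul_laplacian (contDiff_lap hf) hg hc]

/-! ### The fundamental solution of the bilaplacian -/

/-- The profile of the regularised kernel in the variable `r = |x|² + ε`:
`r log r / (16 π)`, so that `r = |x|²` gives `kerG`. -/
noncomputable def profile (r : ℝ) : ℝ := r * Real.log r / (16 * Real.pi)

lemma profile_norm_sq (x : Plane) : profile (‖x‖ ^ 2) = kerG x := by
  rw [profile, kerG, Real.log_pow]
  push_cast
  ring

lemma continuous_profile : Continuous profile :=
  (Real.continuous_mul_log).div_const _

lemma continuous_kerG : Continuous kerG := by
  have : kerG = fun x => profile (‖x‖ ^ 2) := funext fun x => (profile_norm_sq x).symm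
  rw [this]
  exact continuous_profile.comp (by fun_prop)

/-- The regularised kernel `(|x|² + ε) log (|x|² + ε) / (16 π)`. -/
noncomputable def regKer (ε : ℝ) (x : Plane) : ℂ := (profile (‖x‖ ^ 2 + ε) : ℂ)

lemma contDiffAt_profile {r : ℝ} (h : r ≠ 0) : ContDiffAt ℝ ∞ profile r :=
  (contDiffAt_id.mul (Real.contDiffAt_log.2 h)).div_const _

lemma hasDerivAt_profile {r : ℝ} (h : r ≠ 0) :
    HasDerivAt profile ((Real.log r + 1) / (16 * Real.pi)) r := by
  exact (Real.hasDerivAt_mul_log h).div_const (16 * Real.pi)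

/-- First Laplacian of the regularised kernel; for `ε = 0` this covers the kernel itself. -/
lemma laplacian_regKer {ε : ℝ} {x : Plane} (h : ‖x‖ ^ 2 + ε ≠ 0) :
    Laplacian.laplacian (regKer ε) x =
      (((Real.log (‖x‖ ^ 2 + ε) + 2 - ε / (‖x‖ ^ 2 + ε)) / (4 * Real.pi) : ℝ) : ℂ) := by
  have h1 : ∀ᶠ r in 𝓝 (‖x‖ ^ 2), r + ε ≠ 0 :=
    (continuous_id.add continuous_const).continuousAt.eventually_ne h
  have h3 : HasDerivAt (fun r : ℝ => (Real.log (r + ε) + 1) / (16 * Real.pi))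
      ((‖x‖ ^ 2 + ε)⁻¹ / (16 * Real.pi)) (‖x‖ ^ 2) := by
    have := (Real.hasDerivAt_log h).comp_add_const (‖x‖ ^ 2) ε
    simpa using (this.add_const 1).div_const (16 * Real.pi)
  have h2 := laplacian_radial (x := x) (g := fun r => (profile (r + ε) : ℂ))
    (g' := fun r => (((Real.log (r + ε) + 1) / (16 * Real.pi) : ℝ) : ℂ))
    (h1.mono fun r hr => ((hasDerivAt_profile hr).comp_add_const r ε).ofReal_comp)
    h3.ofReal_comp
  rw [show regKer ε = fun y : Plane => (profile (‖y‖ ^ 2 + ε) : ℂ) from rfl, h2,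
    ← Complex.ofReal_mul, ← Complex.ofReal_add, ← Complex.ofReal_ofNat, ← Complex.ofReal_mul]
  congr 1
  have hpi := Real.pi_ne_zero
  field_simp
  ring

lemma bilaplacian_regKer {ε : ℝ} {x : Plane} (h : ‖x‖ ^ 2 + ε ≠ 0) :
    Laplacian.laplacian (Laplacian.laplacian (regKer ε)) x =
      ((2 / Real.pi * (ε ^ 2 / (‖x‖ ^ 2 + ε) ^ 3) : ℝ) : ℂ) := by
  have hn : ∀ᶠ y : Plane in 𝓝 x, ‖y‖ ^ 2 + ε ≠ 0 :=
    (Continuous.continuousAt (f := fun y : Plane => ‖y‖ ^ 2 + ε) (by fun_prop)).eventually_ne h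
  have h0 : Laplacian.laplacian (regKer ε) =ᶠ[𝓝 x] fun y : Plane =>
      (((Real.log (‖y‖ ^ 2 + ε) + 2 - ε / (‖y‖ ^ 2 + ε)) / (4 * Real.pi) : ℝ) : ℂ) :=
    hn.mono fun y hy => laplacian_regKer hy
  rw [laplacian_congr_nhds h0 |>.eq_of_nhds]
  have h1 : ∀ᶠ r in 𝓝 (‖x‖ ^ 2), r + ε ≠ 0 :=
    (continuous_id.add continuous_const).continuousAt.eventually_ne h
  have d0 : ∀ r : ℝ, HasDerivAt (fun r : ℝ => r + ε) 1 r :=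
    fun r => (hasDerivAt_id r).add_const ε
  have hinv : ∀ r : ℝ, r + ε ≠ 0 → HasDerivAt (fun r : ℝ => (r + ε)⁻¹) (-1 / (r + ε) ^ 2) r :=
    fun r hr => (d0 r).fun_inv hr
  have d1 : ∀ r : ℝ, r + ε ≠ 0 → HasDerivAt
      (fun r : ℝ => (Real.log (r + ε) + 2 - ε / (r + ε)) / (4 * Real.pi))
      (((r + ε)⁻¹ + ε * ((r + ε)⁻¹ * (r + ε)⁻¹)) / (4 * Real.pi)) r := by
    intro r hr
    have := ((((d0 r).log hr).add_const 2).sub ((hinv r hr).const_mul ε)).div_const (4 * Real.pi)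
    refine this.congr_deriv ?_
    field_simp
    ring
  have d2 : ∀ r : ℝ, r + ε ≠ 0 → HasDerivAt
      (fun r : ℝ => ((r + ε)⁻¹ + ε * ((r + ε)⁻¹ * (r + ε)⁻¹)) / (4 * Real.pi))
      ((-1 / (r + ε) ^ 2 - 2 * ε / (r + ε) ^ 3) / (4 * Real.pi)) r := by
    intro r hr
    have := ((hinv r hr).add (((hinv r hr).mul (hinv r hr)).const_mul ε)).div_const (4 * Real.pi)
    refine this.congr_deriv ?_
    field_simp
    ring
  have h2 := laplacian_radial (x := x)
    (g := fun r => (((Real.log (r + ε) + 2 - ε / (r + ε)) / (4 * Real.pi) : ℝ) : ℂ))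
    (g' := fun r => ((((r + ε)⁻¹ + ε * ((r + ε)⁻¹ * (r + ε)⁻¹)) / (4 * Real.pi) : ℝ) : ℂ))
    (h1.mono fun r hr => (d1 r hr).ofReal_comp)
    (d2 _ h).ofReal_comp
  rw [h2, ← Complex.ofReal_mul, ← Complex.ofReal_add, ← Complex.ofReal_ofNat, ← Complex.ofReal_mul]
  congr 1
  have hpi := Real.pi_ne_zero
  field_simp
  ring

lemma contDiff_regKer {ε : ℝ} (h : 0 < ε) : ContDiff ℝ ∞ (regKer ε) := by
  refine contDiff_iff_contDiffAt.2 fun x => ?_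
  have h1 : ContDiff ℝ ∞ (fun y : Plane => ‖y‖ ^ 2 + ε) :=
    (contDiff_norm_sq ℝ).add contDiff_const
  have h2 : ContDiffAt ℝ ∞ (fun y : Plane => profile (‖y‖ ^ 2 + ε)) x :=
    (contDiffAt_profile (by positivity)).comp x h1.contDiffAt
  exact Complex.ofRealCLM.contDiff.contDiffAt.comp x h2

/-- The bilaplacian of `regKer 1`, a probability density. -/
noncomputable def bump (x : Plane) : ℝ := 2 / Real.pi * (1 / (‖x‖ ^ 2 + 1) ^ 3)

lemma integrable_bump : Integrable bump := by
  have h := integrable_rpow_neg_one_add_norm_sq (E := Plane) (μ := volume) (r := 6)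
    (by simp; norm_num)
  refine (h.const_mul (2 / Real.pi)).congr (Eventually.of_forall fun x => ?_)
  have h2 : (-(6 : ℝ) / 2) = -((3 : ℕ) : ℝ) := by norm_num
  simp only [bump]
  rw [h2, Real.rpow_neg (by positivity), Real.rpow_natCast, one_div, add_comm]

lemma integral_bump : ∫ x, bump x = 1 := by
  have h := integral_fun_norm_addHaar (volume : Measure Plane)
    (fun r => 2 / Real.pi * (1 / (r ^ 2 + 1) ^ 3))
  have hder : ∀ r : ℝ, HasDerivAt (fun r : ℝ => -(1 / (4 * (r ^ 2 + 1) ^ 2)))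
      (r * (1 / (r ^ 2 + 1) ^ 3)) r := by
    intro r
    have h1 : HasDerivAt (fun r : ℝ => r ^ 2 + 1) (2 * r) r := by
      simpa using (hasDerivAt_pow 2 r).add_const 1
    have h0 : r ^ 2 + 1 ≠ 0 := by positivity
    have h2 := (((h1.fun_pow 2).const_mul 4).fun_inv (by positivity)).fun_neg
    simp only [one_div]
    refine h2.congr_deriv ?_
    field_simp
    norm_num
    ring
  have hlim : Tendsto (fun r : ℝ => -(1 / (4 * (r ^ 2 + 1) ^ 2))) atTop (𝓝 (-0)) := by
    refine Tendsto.neg ?_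
    refine Tendsto.const_div_atTop ?_ 1
    refine Tendsto.const_mul_atTop (by norm_num) ?_
    exact (tendsto_pow_atTop (by norm_num)).comp
      (tendsto_atTop_add_const_right _ _ (tendsto_pow_atTop (by norm_num)))
  have hint : ∫ r in Set.Ioi (0 : ℝ), r * (1 / (r ^ 2 + 1) ^ 3) = 1 / 4 := by
    rw [integral_Ioi_of_hasDerivAt_of_nonneg (a := 0) (hder 0).continuousAt.continuousWithinAt
      (fun r _ => hder r) (fun r hr => by have : (0 : ℝ) < r := hr; positivity) hlim]
    norm_num
  have hvol : (volume : Measure Plane).real (Metric.ball 0 1) = Real.pi := by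
    rw [Measure.real, EuclideanSpace.volume_ball_fin_two]
    simp [Real.pi_pos.le]
  have hfin : Module.finrank ℝ Plane = 2 := by simp
  simp only [bump]
  rw [h, hvol, hfin]
  have : ∀ r : ℝ, r ^ (2 - 1) • (2 / Real.pi * (1 / (r ^ 2 + 1) ^ 3)) =
      2 / Real.pi * (r * (1 / (r ^ 2 + 1) ^ 3)) := by
    intro r
    simp only [smul_eq_mul]
    norm_num
    ring
  simp only [this]
  rw [integral_const_mul, hint]
  simp only [smul_eq_mul, nsmul_eq_mul]
  have := Real.pi_ne_zero
  field_simp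
  norm_num

lemma abs_profile_le {r : ℝ} (hr : 0 ≤ r) : |profile r| ≤ 1 + r ^ 2 := by
  have h1 : |r * Real.log r| ≤ 1 + r ^ 2 := by
    rcases hr.eq_or_lt with h0 | h0
    · simp [← h0]
    rcases le_total r 1 with h1 | h1
    · have := Real.abs_log_mul_self_lt r h0 h1
      rw [mul_comm]
      nlinarith [sq_nonneg r]
    · rw [abs_of_nonneg (mul_nonneg hr (Real.log_nonneg h1))]
      have := Real.log_le_sub_one_of_pos h0
      nlinarith
  rw [profile, abs_div, abs_of_pos (by positivity : (0 : ℝ) < 16 * Real.pi)]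
  exact (div_le_self (abs_nonneg _) (by linarith [Real.pi_gt_three])).trans h1

/-- `G_{2,l}` is a fundamental solution: the bilaplacian of its kernel is the Dirac mass. The
kernel is approximated by `regKer (δ²)`, whose bilaplacian is the probability density `bump`
rescaled by `δ`. -/
theorem integral_kerG_mul_bilaplacian {ζ : Plane → ℂ} (hζ : ContDiff ℝ ∞ ζ)
    (hc : HasCompactSupport ζ) :
    ∫ x, (kerG x : ℂ) * Laplacian.laplacian (Laplacian.laplacian ζ) x = ζ 0 := by
  set δ : ℕ → ℝ := fun n => 1 / ((n : ℝ) + 1) with hδ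
  have hδ0 : ∀ n, 0 < δ n := fun n => by positivity
  have hδ1 : ∀ n, δ n ≤ 1 := fun n => by
    rw [hδ]
    exact (div_le_one (by positivity)).2 (by linarith [(Nat.cast_nonneg n : (0 : ℝ) ≤ n)])
  have hδl : Tendsto δ atTop (𝓝 0) := tendsto_one_div_add_atTop_nhds_zero_nat
  have cL := (contDiff_lap (contDiff_lap hζ)).continuous
  have sL := hasCompactSupport_lap (hasCompactSupport_lap hc)
  have lim1 : Tendsto (fun n => ∫ x, regKer (δ n ^ 2) x *
      Laplacian.laplacian (Laplacian.laplacian ζ) x) atTop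
      (𝓝 (∫ x, (kerG x : ℂ) * Laplacian.laplacian (Laplacian.laplacian ζ) x)) := by
    refine tendsto_integral_of_dominated_convergence
      (fun x => (1 + (‖x‖ ^ 2 + 1) ^ 2) * ‖Laplacian.laplacian (Laplacian.laplacian ζ) x‖)
      ?_ ?_ ?_ ?_
    · intro n
      exact ((contDiff_regKer (by have := hδ0 n; positivity)).continuous.mul
        cL).aestronglyMeasurable
    · exact (Continuous.mul (by fun_prop) cL.norm).integrable_of_hasCompactSupport
        sL.norm.mul_left
    · intro n
      refine Eventually.of_forall fun x => ?_
      rw [norm_mul]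
      refine mul_le_mul_of_nonneg_right ?_ (norm_nonneg _)
      rw [regKer, Complex.norm_real, Real.norm_eq_abs]
      refine (abs_profile_le (by positivity)).trans ?_
      have : δ n ^ 2 ≤ 1 := pow_le_one₀ (hδ0 n).le (hδ1 n)
      gcongr
    · refine Eventually.of_forall fun x => Tendsto.mul_const _ ?_
      rw [← profile_norm_sq]
      refine (Complex.continuous_ofReal.tendsto _).comp ?_
      refine (continuous_profile.tendsto _).comp ?_
      simpa using (tendsto_const_nhds (x := ‖x‖ ^ 2)).add (hδl.pow 2)
  have eq : ∀ n, ∫ x, regKer (δ n ^ 2) x * Laplacian.laplacian (Laplacian.laplacian ζ) x =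
      ∫ z, (bump z : ℂ) * ζ (δ n • z) := by
    intro n
    have hp := hδ0 n
    rw [integral_mul_bilaplacian (contDiff_regKer (by positivity)) hζ hc]
    have h1 := Measure.integral_comp_smul_of_nonneg (volume : Measure Plane)
      (fun x => Laplacian.laplacian (Laplacian.laplacian (regKer (δ n ^ 2))) x * ζ x) (δ n)
      (hR := hp.le)
    have h2 : ∀ z : Plane, Laplacian.laplacian (Laplacian.laplacian (regKer (δ n ^ 2))) (δ n • z)
        * ζ (δ n • z) = ((δ n ^ 2)⁻¹ : ℝ) • ((bump z : ℂ) * ζ (δ n • z)) := by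
      intro z
      rw [bilaplacian_regKer (by positivity), norm_smul, Real.norm_of_nonneg hp.le,
        Complex.real_smul, ← mul_assoc, ← Complex.ofReal_mul]
      congr 2
      rw [bump]
      have := Real.pi_ne_zero
      field_simp
    simp only [h2] at h1
    rw [integral_smul] at h1
    have hfin : Module.finrank ℝ Plane = 2 := by simp
    rw [hfin] at h1
    have h3 : ((δ n ^ 2)⁻¹ : ℝ) ≠ 0 := by positivity
    exact (smul_right_injective ℂ h3 h1).symm
  have lim2 : Tendsto (fun n => ∫ z, (bump z : ℂ) * ζ (δ n • z)) atTop
      (𝓝 (∫ z, (bump z : ℂ) * ζ 0)) := by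
    obtain ⟨C, hC⟩ := hζ.continuous.bounded_above_of_compact_support hc
    have hb : Integrable (fun z => (bump z : ℂ)) := integrable_bump.ofReal
    refine tendsto_integral_of_dominated_convergence (fun z => ‖(bump z : ℂ)‖ * C) ?_ ?_ ?_ ?_
    · intro n
      exact hb.aestronglyMeasurable.mul
        (hζ.continuous.comp (continuous_const_smul _)).aestronglyMeasurable
    · exact hb.norm.mul_const C
    · intro n
      refine Eventually.of_forall fun z => ?_
      rw [norm_mul]
      exact mul_le_mul_of_nonneg_left (hC _) (norm_nonneg _)
    · refine Eventually.of_forall fun z => Tendsto.const_mul _ ?_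
      refine (hζ.continuous.tendsto 0).comp ?_
      simpa using hδl.smul_const z
  have h4 : ∫ z, (bump z : ℂ) * ζ 0 = ζ 0 := by
    rw [integral_mul_const, integral_complex_ofReal, integral_bump]
    simp
  rw [h4] at lim2
  simp only [eq] at lim1
  exact tendsto_nhds_unique lim1 lim2

/-! ### Truncations of the fundamental solution -/

/-- A smooth cut-off function, equal to `1` on the unit disc and supported in the disc of
radius `2`. -/
noncomputable def cutoff : ContDiffBump (0 : Plane) := ⟨1, 2, one_pos, one_lt_two⟩

/-- The part of the kernel `kerG` away from the origin. -/
noncomputable def farK (x : Plane) : ℂ := ((1 - cutoff x : ℝ) : ℂ) * (kerG x : ℂ)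

/-- The part of `|x|² / (8 π)` away from the origin. This function measures how `kerG` fails to be
homogeneous. -/
noncomputable def farQ (x : Plane) : ℂ :=
  ((1 - cutoff x : ℝ) : ℂ) * ((‖x‖ ^ 2 / (8 * Real.pi) : ℝ) : ℂ)

lemma regKer_zero (x : Plane) : regKer 0 x = (kerG x : ℂ) := by
  rw [regKer, add_zero, profile_norm_sq]

lemma contDiff_cutoff_compl : ContDiff ℝ ∞ (fun x : Plane => ((1 - cutoff x : ℝ) : ℂ)) :=
  Complex.ofRealCLM.contDiff.comp (contDiff_const.sub cutoff.contDiff)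

lemma contDiff_farK : ContDiff ℝ ∞ farK := by
  refine contDiff_iff_contDiffAt.2 fun x => ?_
  by_cases hx : x = 0
  · subst hx
    refine (contDiffAt_const (c := (0 : ℂ))).congr_of_eventuallyEq ?_
    filter_upwards [cutoff.eventuallyEq_one] with y hy
    simp [farK, hy]
  · have h1 : ContDiffAt ℝ ∞ (fun y : Plane => (profile (‖y‖ ^ 2) : ℂ)) x := by
      refine Complex.ofRealCLM.contDiff.contDiffAt.comp x ?_
      have : ‖x‖ ^ 2 ≠ 0 := by simpa using hx
      exact (contDiffAt_profile this).comp x (contDiff_norm_sq ℝ).contDiffAt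
    simp only [profile_norm_sq] at h1
    exact contDiff_cutoff_compl.contDiffAt.mul h1

lemma contDiff_farQ : ContDiff ℝ ∞ farQ :=
  contDiff_cutoff_compl.mul
    (Complex.ofRealCLM.contDiff.comp ((contDiff_norm_sq ℝ).div_const _))

lemma cutoff_eq_zero {x : Plane} (hx : 2 ≤ ‖x‖) : cutoff x = 0 :=
  cutoff.zero_of_le_dist (by simpa [cutoff] using hx)

lemma cutoff_eq_one {x : Plane} (hx : ‖x‖ ≤ 1) : cutoff x = 1 :=
  cutoff.one_of_mem_closedBall (by simpa [cutoff] using hx)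

lemma eventually_two_lt_norm {x : Plane} (hx : 2 < ‖x‖) : ∀ᶠ y in 𝓝 x, 2 < ‖y‖ :=
  continuous_norm.continuousAt.eventually_const_lt hx

/-- Outside the support of the cut-off, `farK` is the kernel itself, which is biharmonic away from
the origin. -/
lemma bilaplacian_farK_eq_zero {x : Plane} (hx : 2 < ‖x‖) :
    Laplacian.laplacian (Laplacian.laplacian farK) x = 0 := by
  have h : farK =ᶠ[𝓝 x] regKer 0 := by
    filter_upwards [eventually_two_lt_norm hx] with y hy
    rw [farK, cutoff_eq_zero hy.le, regKer_zero]
    simp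
  rw [(laplacian_congr_nhds (laplacian_congr_nhds h)).eq_of_nhds,
    bilaplacian_regKer (by positivity)]
  simp

lemma bilaplacian_farQ_eq_zero {x : Plane} (hx : 2 < ‖x‖) :
    Laplacian.laplacian (Laplacian.laplacian farQ) x = 0 := by
  have h : farQ =ᶠ[𝓝 x] fun y : Plane => ((‖y‖ ^ 2 / (8 * Real.pi) : ℝ) : ℂ) := by
    filter_upwards [eventually_two_lt_norm hx] with y hy
    rw [farQ, cutoff_eq_zero hy.le]
    simp
  have h2 : Laplacian.laplacian (fun y : Plane => ((‖y‖ ^ 2 / (8 * Real.pi) : ℝ) : ℂ)) =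
      fun _ => 4 * ((1 / (8 * Real.pi) : ℝ) : ℂ) := by
    funext y
    rw [laplacian_radial (g := fun r => ((r / (8 * Real.pi) : ℝ) : ℂ))
      (g' := fun _ => ((1 / (8 * Real.pi) : ℝ) : ℂ)) (g'' := 0)
      (Eventually.of_forall fun r => ((hasDerivAt_id r).div_const _).ofReal_comp)
      (hasDerivAt_const _ _)]
    simp
  rw [(laplacian_congr_nhds (laplacian_congr_nhds h)).eq_of_nhds, h2]
  simp

/-- The kernel `kerG` cut off at scale `R`. -/
noncomputable def nearK (R : ℝ) (x : Plane) : ℂ := ((cutoff (R⁻¹ • x) : ℝ) : ℂ) * (kerG x : ℂ)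

/-- The smooth error in `Δ² (nearK R) = δ₀ - tail R`. It lives at scale `R`; the logarithm comes
from the inhomogeneity of `kerG`. -/
noncomputable def tail (R : ℝ) (x : Plane) : ℂ :=
  ((R⁻¹ ^ 2 : ℝ) : ℂ) * (Laplacian.laplacian (Laplacian.laplacian farK) (R⁻¹ • x) +
    (Real.log R : ℂ) * Laplacian.laplacian (Laplacian.laplacian farQ) (R⁻¹ • x))

lemma kerG_eq_nearK_add {R : ℝ} (hR : 0 < R) (x : Plane) :
    (kerG x : ℂ) = nearK R x +
      ((R ^ 2 : ℝ) : ℂ) * (farK (R⁻¹ • x) + (Real.log R : ℂ) * farQ (R⁻¹ • x)) := by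
  rw [nearK, farK, farQ]
  norm_cast
  rcases eq_or_ne x 0 with rfl | hx
  · simp [kerG]
  have hx' : ‖x‖ ≠ 0 := norm_ne_zero_iff.2 hx
  rw [kerG, kerG, norm_smul, Real.norm_of_nonneg (by positivity),
    Real.log_mul (by positivity) hx', Real.log_inv]
  have := Real.pi_ne_zero
  field_simp
  ring

lemma continuous_nearK (R : ℝ) : Continuous (nearK R) :=
  (Complex.continuous_ofReal.comp (cutoff.continuous.comp (continuous_const_smul _))).mul
    (Complex.continuous_ofReal.comp continuous_kerG)

lemma nearK_eq_zero {R : ℝ} (hR : 0 < R) {x : Plane} (hx : 2 * R ≤ ‖x‖) : nearK R x = 0 := by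
  rw [nearK, cutoff_eq_zero]
  · simp
  · rw [norm_smul, Real.norm_of_nonneg (by positivity), ← div_eq_inv_mul, le_div_iff₀ hR]
    exact hx

lemma hasCompactSupport_nearK {R : ℝ} (hR : 0 < R) : HasCompactSupport (nearK R) := by
  refine HasCompactSupport.intro (isCompact_closedBall 0 (2 * R)) fun x hx => ?_
  refine nearK_eq_zero hR ?_
  simp only [Metric.mem_closedBall, dist_zero_right, not_le] at hx
  exact hx.le

lemma norm_nearK_le (R : ℝ) (x : Plane) : ‖nearK R x‖ ≤ |kerG x| := by
  rw [nearK, norm_mul, Complex.norm_real, Complex.norm_real, Real.norm_of_nonneg cutoff.nonneg]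
  exact mul_le_of_le_one_left (abs_nonneg _) cutoff.le_one

lemma tail_eq_zero {R : ℝ} (hR : 0 < R) {x : Plane} (hx : 2 * R < ‖x‖) : tail R x = 0 := by
  have h : 2 < ‖R⁻¹ • x‖ := by
    rw [norm_smul, Real.norm_of_nonneg (by positivity), ← div_eq_inv_mul, lt_div_iff₀ hR]
    exact hx
  rw [tail, bilaplacian_farK_eq_zero h, bilaplacian_farQ_eq_zero h]
  simp

lemma integral_nearK_mul_bilaplacian {R : ℝ} (hR : 0 < R) {ζ : Plane → ℂ}
    (hζ : ContDiff ℝ ∞ ζ) (hc : HasCompactSupport ζ) :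
    ∫ x, nearK R x * Laplacian.laplacian (Laplacian.laplacian ζ) x =
      ζ 0 - ∫ x, tail R x * ζ x := by
  set Z := Laplacian.laplacian (Laplacian.laplacian ζ) with hZ
  have cZ : Continuous Z := (contDiff_lap (contDiff_lap hζ)).continuous
  have sZ : HasCompactSupport Z := hasCompactSupport_lap (hasCompactSupport_lap hc)
  have sc : ∀ {F : Plane → ℂ}, ContDiff ℝ ∞ F → ContDiff ℝ ∞ (fun x => F (R⁻¹ • x)) :=
    fun hF => hF.comp (contDiff_const_smul _)
  have int : ∀ {F : Plane → ℂ}, Continuous F → Integrable (fun x => F x * Z x) :=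
    fun hF => (hF.mul cZ).integrable_of_hasCompactSupport sZ.mul_left
  have int' : ∀ {F : Plane → ℂ}, Continuous F → Integrable (fun x => F x * ζ x) :=
    fun hF => (hF.mul hζ.continuous).integrable_of_hasCompactSupport hc.mul_left
  have e1 : ∀ {F : Plane → ℂ}, ContDiff ℝ ∞ F → ∫ x, F (R⁻¹ • x) * Z x =
      ((R⁻¹ ^ 4 : ℝ) : ℂ) *
        ∫ x, Laplacian.laplacian (Laplacian.laplacian F) (R⁻¹ • x) * ζ x := by
    intro F hF
    rw [hZ, integral_mul_bilaplacian (sc hF) hζ hc, ← integral_const_mul]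
    refine integral_congr_ae (Eventually.of_forall fun x => ?_)
    simp only
    rw [bilaplacian_comp_smul hF]
    push_cast
    ring
  have lK := contDiff_lap (contDiff_lap contDiff_farK)
  have lQ := contDiff_lap (contDiff_lap contDiff_farQ)
  have h0 := integral_kerG_mul_bilaplacian hζ hc
  have h1 : (∫ x, (kerG x : ℂ) * Z x) = (∫ x, nearK R x * Z x) +
      ((R ^ 2 : ℝ) : ℂ) * ((∫ x, farK (R⁻¹ • x) * Z x) +
        (Real.log R : ℂ) * ∫ x, farQ (R⁻¹ • x) * Z x) := by
    rw [← integral_const_mul (Real.log R : ℂ), ← integral_add (int (sc contDiff_farK).continuous)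
      ((int (sc contDiff_farQ).continuous).const_mul _), ← integral_const_mul,
      ← integral_add (int (continuous_nearK R))]
    · refine integral_congr_ae (Eventually.of_forall fun x => ?_)
      simp only
      rw [kerG_eq_nearK_add hR x]
      ring
    · exact ((int (sc contDiff_farK).continuous).add
        ((int (sc contDiff_farQ).continuous).const_mul _)).const_mul _
  have h2 : ∫ x, tail R x * ζ x = ((R⁻¹ ^ 2 : ℝ) : ℂ) *
      ((∫ x, Laplacian.laplacian (Laplacian.laplacian farK) (R⁻¹ • x) * ζ x) +
        (Real.log R : ℂ) *
          ∫ x, Laplacian.laplacian (Laplacian.laplacian farQ) (R⁻¹ • x) * ζ x) := by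
    rw [← integral_const_mul (Real.log R : ℂ), ← integral_add (int' (sc lK).continuous)
      ((int' (sc lQ).continuous).const_mul _), ← integral_const_mul]
    refine integral_congr_ae (Eventually.of_forall fun x => ?_)
    simp only [tail]
    ring
  rw [e1 contDiff_farK, e1 contDiff_farQ, h0] at h1
  rw [h1, h2]
  have : (R : ℂ) ≠ 0 := by exact_mod_cast hR.ne'
  push_cast
  field_simp
  ring

/-! ### Convolution with functions whose first moments vanish -/

/-- Second order Taylor estimate for a smooth function with compact support. -/
lemma exists_taylor_bound {F : Plane → ℂ} (hF : ContDiff ℝ ∞ F) (hc : HasCompactSupport F) :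
    ∃ C : ℝ, 0 ≤ C ∧ ∀ a b : Plane, ‖F (a - b) - F a + fderiv ℝ F a b‖ ≤ C * ‖b‖ ^ 2 := by
  obtain ⟨C, hC⟩ := ContDiff.lipschitzWith_of_hasCompactSupport (hc.fderiv (𝕜 := ℝ))
    (hF.fderiv_right (m := ∞) (by norm_cast)) (by norm_num)
  refine ⟨C, C.2, fun a b => ?_⟩
  have h := (convex_closedBall a ‖b‖).norm_image_sub_le_of_norm_hasFDerivWithin_le'
    (f := F) (f' := fderiv ℝ F) (φ := fderiv ℝ F a) (C := C * ‖b‖) (x := a) (y := a - b)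
    (fun x _ => (hF.differentiable (by norm_num) x).hasFDerivAt.hasFDerivWithinAt)
    (fun x hx => by
      have := hC.dist_le_mul x a
      rw [dist_eq_norm] at this
      exact this.trans (mul_le_mul_of_nonneg_left (Metric.mem_closedBall.1 hx) C.2))
    (Metric.mem_closedBall_self (norm_nonneg _)) (by simp)
  have e : F (a - b) - F a - fderiv ℝ F a (a - b - a) = F (a - b) - F a + fderiv ℝ F a b := by
    rw [show a - b - a = -b by abel, map_neg, sub_neg_eq_add]
  rw [e] at h
  refine h.trans (le_of_eq ?_)
  rw [show a - b - a = -b by abel, norm_neg]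
  ring

lemma continuous_mono (i : Fin 3) : Continuous (mono i) := by
  fin_cases i <;> simp [mono] <;> fun_prop

lemma integral_affine_mul_eq_zero {ψ : Plane → ℂ} (hψ : Continuous ψ) (hc : HasCompactSupport ψ)
    (hm : ∀ i, ∫ x, (mono i x : ℂ) * ψ x = 0) (a : ℂ) (L : Plane →L[ℝ] ℂ) :
    ∫ x, (a - L x) * ψ x = 0 := by
  have int : ∀ i, Integrable (fun x => (mono i x : ℂ) * ψ x) := fun i =>
    ((Complex.continuous_ofReal.comp (continuous_mono i)).mul hψ).integrable_of_hasCompactSupport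
      hc.mul_left
  have h : ∀ x, (a - L x) * ψ x = a * ((mono 0 x : ℂ) * ψ x) -
      (L (frame 0) * ((mono 1 x : ℂ) * ψ x) + L (frame 1) * ((mono 2 x : ℂ) * ψ x)) := by
    intro x
    have hx : x = (x 0) • frame 0 + (x 1) • frame 1 := by
      ext i
      fin_cases i <;> simp
    have hL : L x = (x 0 : ℂ) * L (frame 0) + (x 1 : ℂ) * L (frame 1) := by
      conv_lhs => rw [hx]
      rw [map_add, map_smul, map_smul, Complex.real_smul, Complex.real_smul]
    rw [hL]
    simp [mono]
    ring
  simp only [h]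
  have h12 : Integrable (fun x => L (frame 0) * ((mono 1 x : ℂ) * ψ x) +
      L (frame 1) * ((mono 2 x : ℂ) * ψ x)) := ((int 1).const_mul _).add ((int 2).const_mul _)
  rw [integral_sub ((int 0).const_mul _) h12,
    integral_add ((int 1).const_mul _) ((int 2).const_mul _)]
  simp only [integral_const_mul, hm]
  simp

/-- Vanishing first moments of `ψ` gain two powers of the dilation factor: subtract the first order
Taylor polynomial of `F` at `a • x`. -/
lemma exists_convolution_bound {F : Plane → ℂ} (hF : ContDiff ℝ ∞ F) (hc : HasCompactSupport F)
    {ψ : Plane → ℂ} (hψ : Continuous ψ) (hψc : HasCompactSupport ψ)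
    (hm : ∀ i, ∫ x, (mono i x : ℂ) * ψ x = 0) :
    ∃ C : ℝ, 0 ≤ C ∧ ∀ (a : ℝ) (x : Plane), ‖∫ y, F (a • y) * ψ (x - y)‖ ≤ C * a ^ 2 := by
  obtain ⟨C, hC0, hC⟩ := exists_taylor_bound hF hc
  refine ⟨∫ y, C * (‖y‖ ^ 2 * ‖ψ y‖), integral_nonneg fun y => by positivity, fun a x => ?_⟩
  have h1 : ∫ y, F (a • y) * ψ (x - y) = ∫ y, F (a • (x - y)) * ψ y := by
    rw [← integral_sub_left_eq_self (fun y => F (a • y) * ψ (x - y)) volume x]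
    simp
  have i1 : Integrable (fun y => F (a • (x - y)) * ψ y) :=
    ((hF.continuous.comp (by fun_prop)).mul hψ).integrable_of_hasCompactSupport hψc.mul_left
  have h2 := integral_affine_mul_eq_zero hψ hψc hm (F (a • x)) (a • fderiv ℝ F (a • x))
  have i2 : Integrable (fun y => (F (a • x) - (a • fderiv ℝ F (a • x)) y) * ψ y) :=
    (Continuous.mul (by fun_prop) hψ).integrable_of_hasCompactSupport hψc.mul_left
  have h3 : ∫ y, F (a • (x - y)) * ψ y =
      ∫ y, (F (a • (x - y)) * ψ y - (F (a • x) - (a • fderiv ℝ F (a • x)) y) * ψ y) := by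
    rw [integral_sub i1 i2, h2, sub_zero]
  rw [h1, h3, mul_comm, ← integral_const_mul]
  refine norm_integral_le_of_norm_le ?_ (Eventually.of_forall fun y => ?_)
  · exact (Continuous.integrable_of_hasCompactSupport (by fun_prop)
      (hψc.norm.mul_left.mul_left)).const_mul _
  · have h4 := hC (a • x) (a • y)
    rw [← sub_mul, norm_mul]
    have h5 : F (a • (x - y)) - (F (a • x) - (a • fderiv ℝ F (a • x)) y) =
        F (a • x - a • y) - F (a • x) + fderiv ℝ F (a • x) (a • y) := by
      rw [smul_sub, map_smul, smul_apply]
      ring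
    rw [h5]
    calc _ ≤ C * ‖a • y‖ ^ 2 * ‖ψ y‖ := mul_le_mul_of_nonneg_right h4 (norm_nonneg _)
      _ = _ := by
        rw [norm_smul, mul_pow, Real.norm_eq_abs, sq_abs]
        ring

lemma laplacian_convolution {k ψ : Plane → ℂ} (hk : Continuous k) (hψ : ContDiff ℝ ∞ ψ)
    (hc : HasCompactSupport ψ) (x : Plane) :
    Laplacian.laplacian (fun x => ∫ y, k y * ψ (x - y)) x =
      ∫ y, k y * Laplacian.laplacian ψ (x - y) := by
  have hl : LocallyIntegrable k := hk.locallyIntegrable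
  have hcon : ∀ g : Plane → ℂ, (fun x => ∫ y, k y * g (x - y)) =
      convolution k g (ContinuousLinearMap.mul ℝ ℂ) volume := fun g => rfl
  have hd : ∀ {g : Plane → ℂ}, ContDiff ℝ ∞ g → HasCompactSupport g → ∀ (v x : Plane),
      fderiv ℝ (fun x => ∫ y, k y * g (x - y)) x v =
        ∫ y, k y * (fun z => fderiv ℝ g z v) (x - y) := by
    intro g hg hgc v x
    rw [hcon, (hgc.hasFDerivAt_convolution_right (ContinuousLinearMap.mul ℝ ℂ) hl
      (hg.of_le (by norm_cast)) x).fderiv, convolution_precompR_apply _ hl (hgc.fderiv (𝕜 := ℝ))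
      (hg.continuous_fderiv (by norm_num))]
    rfl
  have hs : ContDiff ℝ ∞ (fun x => ∫ y, k y * ψ (x - y)) := by
    rw [hcon]
    exact hc.contDiff_convolution_right (n := ⊤) (ContinuousLinearMap.mul ℝ ℂ) hl hψ
  rw [laplacian_eq_sum hs]
  have h2 : ∀ i, fderiv ℝ (fun y => fderiv ℝ (fun x => ∫ y, k y * ψ (x - y)) y (frame i)) x
      (frame i) = ∫ y, k y * (fun w => fderiv ℝ (fun z => fderiv ℝ ψ z (frame i)) w (frame i))
        (x - y) := by
    intro i
    rw [show (fun y => fderiv ℝ (fun x => ∫ y, k y * ψ (x - y)) y (frame i)) =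
      fun x => ∫ y, k y * (fun z => fderiv ℝ ψ z (frame i)) (x - y) from
      funext fun x => hd hψ hc _ x]
    exact hd (contDiff_fderiv_apply hψ _) (hc.fderiv_apply (𝕜 := ℝ) _) _ x
  simp only [h2, laplacian_eq_sum hψ, Finset.mul_sum]
  rw [integral_finsetSum]
  intro i _
  have c2 := contDiff_fderiv_apply (contDiff_fderiv_apply hψ (frame i)) (frame i)
  have s2 := (hc.fderiv_apply (𝕜 := ℝ) (frame i)).fderiv_apply (𝕜 := ℝ) (frame i)
  have := (hk.mul (c2.continuous.comp (continuous_const.sub continuous_id))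
    ).integrable_of_hasCompactSupport (μ := volume)
    ((s2.comp_homeomorph (Homeomorph.subLeft x)).mul_left (f := k))
  exact this

lemma contDiff_convolution {k ψ : Plane → ℂ} (hk : Continuous k) (hψ : ContDiff ℝ ∞ ψ)
    (hc : HasCompactSupport ψ) : ContDiff ℝ ∞ (fun x => ∫ y, k y * ψ (x - y)) :=
  hc.contDiff_convolution_right (n := ⊤) (ContinuousLinearMap.mul ℝ ℂ) hk.locallyIntegrable hψ

lemma hasCompactSupport_convolution {k ψ : Plane → ℂ} (hk : HasCompactSupport k)
    (hc : HasCompactSupport ψ) : HasCompactSupport (fun x => ∫ y, k y * ψ (x - y)) :=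
  hk.convolution (ContinuousLinearMap.mul ℝ ℂ) hc

lemma bilaplacian_convolution {k ψ : Plane → ℂ} (hk : Continuous k) (hψ : ContDiff ℝ ∞ ψ)
    (hc : HasCompactSupport ψ) (x : Plane) :
    Laplacian.laplacian (Laplacian.laplacian (fun x => ∫ y, k y * ψ (x - y))) x =
      ∫ y, k y * Laplacian.laplacian (Laplacian.laplacian ψ) (x - y) := by
  rw [show Laplacian.laplacian (fun x => ∫ y, k y * ψ (x - y)) = _ from
    funext fun x => laplacian_convolution hk hψ hc x,
    laplacian_convolution hk (contDiff_lap hψ) (hasCompactSupport_lap hc)]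

/-! ### The potential `G_{2,l} w` of a weighted integrable function -/

lemma kerG_neg_sub (x y : Plane) : kerG (y - x) = kerG (x - y) := by
  rw [kerG, kerG, norm_sub_rev]

lemma integrable_kerG_mul {w : Plane → ℂ} (hw : Integrable (fun x => ((1 + ‖x‖) ^ 3 : ℝ) * w x))
    (hm : AEStronglyMeasurable w) (x : Plane) :
    Integrable (fun y => (kerG (x - y) : ℂ) * w y) := by
  refine (hw.norm.const_mul ((1 + ‖x‖) ^ 3)).mono' ?_ (Eventually.of_forall fun y => ?_)
  · exact (Complex.continuous_ofReal.comp
      (continuous_kerG.comp (continuous_const.sub continuous_id))).aestronglyMeasurable.mul hm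
  · rw [norm_mul, norm_mul, Complex.norm_real, Complex.norm_real, Real.norm_eq_abs,
      Real.norm_of_nonneg (by positivity : (0 : ℝ) ≤ (1 + ‖y‖) ^ 3), ← mul_assoc]
    exact mul_le_mul_of_nonneg_right (abs_kerG_le x y) (norm_nonneg _)

lemma norm_convG_le {w : Plane → ℂ} (hw : Integrable (fun x => ((1 + ‖x‖) ^ 3 : ℝ) * w x))
    (x : Plane) :
    ‖convG w x‖ ≤ (∫ y, ‖((1 + ‖y‖) ^ 3 : ℝ) * w y‖) * (1 + ‖x‖) ^ 3 := by
  rw [mul_comm, ← integral_const_mul]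
  refine norm_integral_le_of_norm_le (hw.norm.const_mul _) (Eventually.of_forall fun y => ?_)
  rw [norm_mul, norm_mul, Complex.norm_real, Complex.norm_real, Real.norm_eq_abs,
    Real.norm_of_nonneg (by positivity : (0 : ℝ) ≤ (1 + ‖y‖) ^ 3), ← mul_assoc]
  exact mul_le_mul_of_nonneg_right (abs_kerG_le x y) (norm_nonneg _)

lemma aestronglyMeasurable_convG {w : Plane → ℂ} (hm : AEStronglyMeasurable w) :
    AEStronglyMeasurable (convG w) := by
  refine AEStronglyMeasurable.integral_prod_right'
    (f := fun p : Plane × Plane => (kerG (p.1 - p.2) : ℂ) * w p.2) ?_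
  refine AEStronglyMeasurable.mul ?_ hm.comp_snd
  exact (Complex.measurable_ofReal.comp
    (measurable_kerG.comp (measurable_fst.sub measurable_snd))).aestronglyMeasurable

lemma aestronglyMeasurable_of_weighted {w : Plane → ℂ}
    (hw : Integrable (fun x => ((1 + ‖x‖) ^ 3 : ℝ) * w x)) : AEStronglyMeasurable w := by
  have hc : Continuous (fun x : Plane => (((1 + ‖x‖) ^ 3 : ℝ) : ℂ)⁻¹) := by
    refine Continuous.inv₀ (by fun_prop) fun x => ?_
    exact_mod_cast (by positivity : (1 + ‖x‖) ^ 3 ≠ 0)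
  refine (hc.aestronglyMeasurable.mul hw.aestronglyMeasurable).congr
    (Eventually.of_forall fun x => ?_)
  have : (((1 + ‖x‖) ^ 3 : ℝ) : ℂ) ≠ 0 := by
    exact_mod_cast (by positivity : (1 + ‖x‖) ^ 3 ≠ 0)
  simp only [Pi.mul_apply]
  rw [inv_mul_cancel_left₀ this]

lemma integrable_of_weighted {w : Plane → ℂ}
    (hw : Integrable (fun x => ((1 + ‖x‖) ^ 3 : ℝ) * w x)) : Integrable w := by
  refine hw.mono (aestronglyMeasurable_of_weighted hw) (Eventually.of_forall fun x => ?_)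
  rw [norm_mul, Complex.norm_real, Real.norm_of_nonneg (by positivity)]
  exact le_mul_of_one_le_left (norm_nonneg _) (one_le_pow₀ (by linarith [norm_nonneg x]))

lemma locallyIntegrable_convG {w : Plane → ℂ}
    (hw : Integrable (fun x => ((1 + ‖x‖) ^ 3 : ℝ) * w x)) : LocallyIntegrable (convG w) := by
  refine (Continuous.locallyIntegrable (μ := volume)
    (f := fun x : Plane => (∫ y, ‖((1 + ‖y‖) ^ 3 : ℝ) * w y‖) * (1 + ‖x‖) ^ 3)
    (by fun_prop)).mono (aestronglyMeasurable_convG (aestronglyMeasurable_of_weighted hw))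
    (Eventually.of_forall fun x => ?_)
  exact (norm_convG_le hw x).trans (le_abs_self _)

/-- The convolution with `kerG` is symmetric. -/
lemma integral_convG_mul {w : Plane → ℂ} (hw : Integrable (fun x => ((1 + ‖x‖) ^ 3 : ℝ) * w x))
    {ζ : Plane → ℂ} (hζ : Continuous ζ) (hc : HasCompactSupport ζ) :
    ∫ x, convG w x * ζ x = ∫ y, w y * convG ζ y := by
  have hm := aestronglyMeasurable_of_weighted hw
  have iζ : Integrable (fun x => ((1 + ‖x‖) ^ 3 : ℝ) * ζ x) :=
    (Continuous.mul (by fun_prop) hζ).integrable_of_hasCompactSupport hc.mul_left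
  have h1 : ∀ x, convG w x * ζ x = ∫ y, (kerG (x - y) : ℂ) * w y * ζ x := fun x => by
    rw [convG, integral_mul_const]
  have h2 : ∀ y, w y * convG ζ y = ∫ x, (kerG (x - y) : ℂ) * w y * ζ x := fun y => by
    rw [convG, ← integral_const_mul]
    refine integral_congr_ae (Eventually.of_forall fun x => ?_)
    simp only
    rw [kerG_neg_sub]
    ring
  simp only [h1, h2]
  refine integral_integral_swap (f := fun x y => (kerG (x - y) : ℂ) * w y * ζ x) ?_
  refine (iζ.norm.mul_prod hw.norm).mono' ?_ (Eventually.of_forall fun p => ?_)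
  · refine AEStronglyMeasurable.mul (AEStronglyMeasurable.mul ?_ hm.comp_snd)
      hζ.aestronglyMeasurable.comp_fst
    exact (Complex.continuous_ofReal.comp
      (continuous_kerG.comp (continuous_fst.sub continuous_snd))).aestronglyMeasurable
  · simp only [Function.uncurry, norm_mul, Complex.norm_real, Real.norm_eq_abs]
    have h3 := abs_kerG_le p.1 p.2
    rw [abs_of_nonneg (by positivity : 0 ≤ (1 + ‖p.1‖) ^ 3),
      abs_of_nonneg (by positivity : 0 ≤ (1 + ‖p.2‖) ^ 3)]
    calc _ ≤ (1 + ‖p.1‖) ^ 3 * (1 + ‖p.2‖) ^ 3 * ‖w p.2‖ * ‖ζ p.1‖ := by gcongr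
      _ = _ := by ring

lemma convG_eq (ζ : Plane → ℂ) (x : Plane) :
    convG ζ x = ∫ y, (kerG y : ℂ) * ζ (x - y) := by
  rw [convG, ← integral_sub_left_eq_self (fun y => (kerG y : ℂ) * ζ (x - y)) volume x]
  simp

/-- `Δ² G_{2,l} w = w` in the sense of distributions. -/
theorem integral_convG_mul_bilaplacian {w : Plane → ℂ}
    (hw : Integrable (fun x => ((1 + ‖x‖) ^ 3 : ℝ) * w x))
    {ψ : Plane → ℂ} (hψ : ContDiff ℝ ∞ ψ) (hc : HasCompactSupport ψ) :
    ∫ x, convG w x * Laplacian.laplacian (Laplacian.laplacian ψ) x = ∫ x, w x * ψ x := by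
  rw [integral_convG_mul hw (contDiff_lap (contDiff_lap hψ)).continuous
    (hasCompactSupport_lap (hasCompactSupport_lap hc))]
  refine integral_congr_ae (Eventually.of_forall fun x => ?_)
  simp only
  congr 1
  have hs : ContDiff ℝ ∞ (fun y => ψ (x - y)) := hψ.comp (contDiff_const.sub contDiff_id)
  have hsc : HasCompactSupport (fun y => ψ (x - y)) := hc.comp_homeomorph (Homeomorph.subLeft x)
  have h := integral_kerG_mul_bilaplacian hs hsc
  rw [sub_zero] at h
  rw [convG_eq, ← h]
  refine integral_congr_ae (Eventually.of_forall fun y => ?_)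
  simp only
  congr 1
  rw [show Laplacian.laplacian (fun y => ψ (x - y)) = fun y => Laplacian.laplacian ψ (x - y) from
    funext fun y => laplacian_comp_const_sub hψ x y, laplacian_comp_const_sub (contDiff_lap hψ)]

/-! ### Distributional solutions of linear growth -/

lemma bilaplacian_nearK_convolution {R : ℝ} (hR : 0 < R) {ψ : Plane → ℂ} (hψ : ContDiff ℝ ∞ ψ)
    (hc : HasCompactSupport ψ) (x : Plane) :
    Laplacian.laplacian (Laplacian.laplacian (fun x => ∫ y, nearK R y * ψ (x - y))) x =
      ψ x - ∫ y, tail R y * ψ (x - y) := by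
  rw [bilaplacian_convolution (continuous_nearK R) hψ hc]
  have hs : ContDiff ℝ ∞ (fun y => ψ (x - y)) := hψ.comp (contDiff_const.sub contDiff_id)
  have hsc : HasCompactSupport (fun y => ψ (x - y)) := hc.comp_homeomorph (Homeomorph.subLeft x)
  have h := integral_nearK_mul_bilaplacian hR hs hsc
  rw [sub_zero] at h
  rw [← h]
  refine integral_congr_ae (Eventually.of_forall fun y => ?_)
  simp only
  congr 1
  rw [show Laplacian.laplacian (fun y => ψ (x - y)) = fun y => Laplacian.laplacian ψ (x - y) from
    funext fun y => laplacian_comp_const_sub hψ x y, laplacian_comp_const_sub (contDiff_lap hψ)]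

lemma exists_tail_bound {ψ : Plane → ℂ} (hψ : Continuous ψ) (hc : HasCompactSupport ψ)
    (hm : ∀ i, ∫ x, (mono i x : ℂ) * ψ x = 0) :
    ∃ C : ℝ, 0 ≤ C ∧ ∀ R : ℝ, 1 ≤ R → ∀ x : Plane,
      ‖∫ y, tail R y * ψ (x - y)‖ ≤ C * (1 + Real.log R) * R⁻¹ ^ 4 := by
  have cs : ∀ {F : Plane → ℂ}, (∀ x : Plane, 2 < ‖x‖ → F x = 0) → HasCompactSupport F := by
    intro F h
    refine HasCompactSupport.intro (isCompact_closedBall 0 2) fun x hx => h x ?_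
    simpa using hx
  have dK := contDiff_lap (contDiff_lap contDiff_farK)
  have dQ := contDiff_lap (contDiff_lap contDiff_farQ)
  obtain ⟨A, hA0, hA⟩ := exists_convolution_bound dK (cs fun x => bilaplacian_farK_eq_zero)
    hψ hc hm
  obtain ⟨B, hB0, hB⟩ := exists_convolution_bound dQ (cs fun x => bilaplacian_farQ_eq_zero)
    hψ hc hm
  refine ⟨A + B, by positivity, fun R hR x => ?_⟩
  have int : ∀ {F : Plane → ℂ}, Continuous F → Integrable (fun y => F (R⁻¹ • y) * ψ (x - y)) :=
    fun hF => ((hF.comp (continuous_const_smul _)).mul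
      (hψ.comp (continuous_const.sub continuous_id))).integrable_of_hasCompactSupport
      ((hc.comp_homeomorph (Homeomorph.subLeft x)).mul_left)
  have h : ∫ y, tail R y * ψ (x - y) = ((R⁻¹ ^ 2 : ℝ) : ℂ) *
      ((∫ y, Laplacian.laplacian (Laplacian.laplacian farK) (R⁻¹ • y) * ψ (x - y)) +
        (Real.log R : ℂ) *
          ∫ y, Laplacian.laplacian (Laplacian.laplacian farQ) (R⁻¹ • y) * ψ (x - y)) := by
    rw [← integral_const_mul (Real.log R : ℂ), ← integral_add (int dK.continuous)
      ((int dQ.continuous).const_mul _), ← integral_const_mul]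
    refine integral_congr_ae (Eventually.of_forall fun x => ?_)
    simp only [tail]
    ring
  have hl := Real.log_nonneg hR
  rw [h, norm_mul, Complex.norm_real, Real.norm_of_nonneg (by positivity)]
  calc R⁻¹ ^ 2 * ‖_‖ ≤ R⁻¹ ^ 2 * (A * R⁻¹ ^ 2 + Real.log R * (B * R⁻¹ ^ 2)) := by
        refine mul_le_mul_of_nonneg_left ((norm_add_le _ _).trans (add_le_add (hA _ _) ?_))
          (by positivity)
        rw [norm_mul, Complex.norm_real, Real.norm_of_nonneg hl]
        exact mul_le_mul_of_nonneg_left (hB _ _) hl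
    _ = (A + Real.log R * B) * R⁻¹ ^ 4 := by ring
    _ ≤ (A + B) * (1 + Real.log R) * R⁻¹ ^ 4 := by
        refine mul_le_mul_of_nonneg_right ?_ (by positivity)
        nlinarith [mul_nonneg hA0 hl, mul_nonneg hB0 hl]

lemma jap_le (x : Plane) : jap x ≤ 1 + ‖x‖ := by
  rw [jap]
  exact Real.sqrt_le_iff.2 ⟨by positivity, by nlinarith [norm_nonneg x]⟩

/-- A function of linear growth cannot see the error term of the truncated kernel, tested against
a function with vanishing first moments: the error is at most `R⁻⁴ log R` on a disc of radius
comparable to `R`. -/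
lemma tendsto_integral_mul_tail {φ : Plane → ℂ} {C : ℝ} (hφ : ∀ᵐ x : Plane, ‖φ x‖ ≤ C * jap x)
    {ψ : Plane → ℂ} (hψ : Continuous ψ) (hc : HasCompactSupport ψ)
    (hm : ∀ i, ∫ x, (mono i x : ℂ) * ψ x = 0) :
    Tendsto (fun n : ℕ => ∫ x, φ x * ∫ y, tail ((n : ℝ) + 1) y * ψ (x - y)) atTop (𝓝 0) := by
  obtain ⟨B, hB0, hB⟩ := exists_tail_bound hψ hc hm
  obtain ⟨ρ, hρ0, hρ⟩ := hc.isCompact.isBounded.exists_pos_norm_le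
  have hψ0 : ∀ z : Plane, ρ < ‖z‖ → ψ z = 0 := fun z hz => by
    by_contra h
    exact absurd (hρ z (subset_tsupport _ h)) (not_le.2 hz)
  have hvol : ∀ r : ℝ, 0 ≤ r → (volume : Measure Plane).real (Metric.closedBall 0 r) =
      r ^ 2 * Real.pi := by
    intro r hr
    rw [Measure.real, EuclideanSpace.volume_closedBall_fin_two, ENNReal.toReal_mul,
      ENNReal.toReal_pow, ENNReal.toReal_ofReal hr]
    simp [Real.pi_pos.le]
  have key : ∀ n : ℕ, ‖∫ x, φ x * ∫ y, tail ((n : ℝ) + 1) y * ψ (x - y)‖ ≤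
      |C| * (3 + ρ) * B * ((2 + ρ) ^ 2 * Real.pi) *
        ((1 + Real.log ((n : ℝ) + 1)) / ((n : ℝ) + 1)) := by
    intro n
    set R : ℝ := (n : ℝ) + 1 with hR
    have hR1 : 1 ≤ R := by simp [hR]
    have hl := Real.log_nonneg hR1
    have hz : ∀ x, x ∉ Metric.closedBall (0 : Plane) (2 * R + ρ) →
        φ x * ∫ y, tail R y * ψ (x - y) = 0 := by
      intro x hx
      rw [integral_eq_zero_of_ae, mul_zero]
      refine Eventually.of_forall fun y => ?_
      simp only [Metric.mem_closedBall, dist_zero_right, not_le] at hx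
      rcases lt_or_ge (2 * R) ‖y‖ with h | h
      · simp [tail_eq_zero (by linarith) h]
      · have : ρ < ‖x - y‖ := by linarith [norm_sub_norm_le x y]
        simp [hψ0 _ this]
    rw [← setIntegral_eq_integral_of_forall_compl_eq_zero hz]
    refine (norm_setIntegral_le_of_norm_le_const_ae
      (C := |C| * ((3 + ρ) * R) * (B * (1 + Real.log R) * R⁻¹ ^ 4))
      measure_closedBall_lt_top ?_).trans ?_
    · refine (ae_restrict_iff' Metric.isClosed_closedBall.measurableSet).2 ?_
      filter_upwards [hφ] with x hx hxb
      rw [norm_mul]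
      refine mul_le_mul (hx.trans ?_) (hB R hR1 x) (norm_nonneg _) (by positivity)
      have hj : jap x ≤ (3 + ρ) * R := by
        have h1 : ‖x‖ ≤ 2 * R + ρ := by simpa using hxb
        nlinarith [jap_le x]
      have := one_le_jap x
      exact mul_le_mul (le_abs_self C) hj (by linarith) (abs_nonneg C)
    · rw [hvol _ (by positivity)]
      have hs : (2 * R + ρ) ^ 2 ≤ ((2 + ρ) * R) ^ 2 := by
        refine pow_le_pow_left₀ (by positivity) ?_ 2
        nlinarith
      calc _ ≤ |C| * ((3 + ρ) * R) * (B * (1 + Real.log R) * R⁻¹ ^ 4) *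
            (((2 + ρ) * R) ^ 2 * Real.pi) := by gcongr
        _ = _ := by field_simp
  refine squeeze_zero_norm key ?_
  have h1 : Tendsto (fun t : ℝ => (1 + Real.log t) / t) atTop (𝓝 0) := by
    have a : Tendsto (fun t : ℝ => 1 / t) atTop (𝓝 0) := by
      simpa using tendsto_inv_atTop_zero (𝕜 := ℝ)
    have b : Tendsto (fun t : ℝ => Real.log t / t) atTop (𝓝 0) :=
      (Real.isLittleO_log_id_atTop).tendsto_div_nhds_zero
    simpa [add_div] using a.add b
  have h2 : Tendsto (fun n : ℕ => (n : ℝ) + 1) atTop atTop :=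
    tendsto_atTop_add_const_right _ _ tendsto_natCast_atTop_atTop
  simpa using (h1.comp h2).const_mul (|C| * (3 + ρ) * B * ((2 + ρ) ^ 2 * Real.pi))

lemma tendsto_integral_mul_nearK {w : Plane → ℂ}
    (hw : Integrable (fun x => ((1 + ‖x‖) ^ 3 : ℝ) * w x))
    {ψ : Plane → ℂ} (hψ : ContDiff ℝ ∞ ψ) (hc : HasCompactSupport ψ) :
    Tendsto (fun n : ℕ => ∫ x, w x * ∫ y, nearK ((n : ℝ) + 1) y * ψ (x - y)) atTop
      (𝓝 (∫ x, w x * convG ψ x)) := by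
  have iψ : Integrable (fun x => ((1 + ‖x‖) ^ 3 : ℝ) * ψ x) :=
    (Continuous.mul (by fun_prop) hψ.continuous).integrable_of_hasCompactSupport hc.mul_left
  obtain ⟨ρ, hρ0, hρ⟩ := hc.isCompact.isBounded.exists_pos_norm_le
  have hψ0 : ∀ z : Plane, ρ < ‖z‖ → ψ z = 0 := fun z hz => by
    by_contra h
    exact absurd (hρ z (subset_tsupport _ h)) (not_le.2 hz)
  refine tendsto_integral_of_dominated_convergence
    (fun x => (∫ y, ‖((1 + ‖y‖) ^ 3 : ℝ) * ψ y‖) * ‖((1 + ‖x‖) ^ 3 : ℝ) * w x‖) ?_ ?_ ?_ ?_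
  · intro n
    exact (aestronglyMeasurable_of_weighted hw).mul
      (contDiff_convolution (continuous_nearK _) hψ hc).continuous.aestronglyMeasurable
  · exact hw.norm.const_mul _
  · intro n
    refine Eventually.of_forall fun x => ?_
    have h1 : ∫ y, nearK ((n : ℝ) + 1) y * ψ (x - y) =
        ∫ y, nearK ((n : ℝ) + 1) (x - y) * ψ y := by
      rw [← integral_sub_left_eq_self (fun y => nearK ((n : ℝ) + 1) y * ψ (x - y)) volume x]
      simp
    have h2 : ‖∫ y, nearK ((n : ℝ) + 1) y * ψ (x - y)‖ ≤
        (1 + ‖x‖) ^ 3 * ∫ y, ‖((1 + ‖y‖) ^ 3 : ℝ) * ψ y‖ := by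
      rw [h1, ← integral_const_mul]
      refine norm_integral_le_of_norm_le (iψ.norm.const_mul _) (Eventually.of_forall fun y => ?_)
      rw [norm_mul, norm_mul, Complex.norm_real,
        Real.norm_of_nonneg (by positivity : (0 : ℝ) ≤ (1 + ‖y‖) ^ 3), ← mul_assoc]
      exact mul_le_mul_of_nonneg_right ((norm_nearK_le _ _).trans (abs_kerG_le x y))
        (norm_nonneg _)
    rw [norm_mul, norm_mul, Complex.norm_real,
      Real.norm_of_nonneg (by positivity : (0 : ℝ) ≤ (1 + ‖x‖) ^ 3)]
    calc _ ≤ ‖w x‖ * ((1 + ‖x‖) ^ 3 * ∫ y, ‖((1 + ‖y‖) ^ 3 : ℝ) * ψ y‖) :=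
          mul_le_mul_of_nonneg_left h2 (norm_nonneg _)
      _ = _ := by ring
  · refine Eventually.of_forall fun x => Tendsto.const_mul _ ?_
    refine tendsto_const_nhds.congr' ?_
    obtain ⟨N, hN⟩ := exists_nat_ge (‖x‖ + ρ)
    filter_upwards [eventually_ge_atTop N] with n hn
    rw [convG_eq]
    refine integral_congr_ae (Eventually.of_forall fun y => ?_)
    simp only
    rcases lt_or_ge ρ ‖x - y‖ with h | h
    · simp [hψ0 _ h]
    · have hn' : (N : ℝ) ≤ n := by exact_mod_cast hn
      have hy : ‖y‖ ≤ (n : ℝ) + 1 := by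
        have := norm_sub_norm_le y x
        rw [norm_sub_rev] at this
        linarith
      have h1 : cutoff (((n : ℝ) + 1)⁻¹ • y) = 1 := by
        refine cutoff_eq_one ?_
        rw [norm_smul, Real.norm_of_nonneg (by positivity), ← div_eq_inv_mul,
          div_le_one (by positivity)]
        exact hy
      rw [nearK, h1]
      simp

/-- A distributional solution of `Δ² φ = w` of linear growth agrees with `G_{2,l} w` on test
functions whose first moments vanish. -/
lemma integral_mul_eq_integral_convG_mul {φ w : Plane → ℂ} {C : ℝ}
    (hφm : AEStronglyMeasurable φ) (hφ : ∀ᵐ x : Plane, ‖φ x‖ ≤ C * jap x)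
    (hw : Integrable (fun x => ((1 + ‖x‖) ^ 3 : ℝ) * w x))
    (heq : ∀ ψ : Plane → ℂ, ContDiff ℝ ∞ ψ → HasCompactSupport ψ →
      ∫ x, φ x * Laplacian.laplacian (Laplacian.laplacian ψ) x = ∫ x, w x * ψ x)
    {ψ : Plane → ℂ} (hψ : ContDiff ℝ ∞ ψ) (hc : HasCompactSupport ψ)
    (hm : ∀ i, ∫ x, (mono i x : ℂ) * ψ x = 0) :
    ∫ x, φ x * ψ x = ∫ x, convG w x * ψ x := by
  have hcont : Continuous (fun x : Plane => C * jap x) := continuous_const.mul continuous_jap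
  have hloc : LocallyIntegrable φ := hcont.locallyIntegrable.mono hφm
    (by filter_upwards [hφ] with x hx using hx.trans (le_abs_self _))
  have t1 := tendsto_integral_mul_tail hφ hψ.continuous hc hm
  have t2 := tendsto_integral_mul_nearK hw hψ hc
  have h : ∀ n : ℕ, ∫ x, w x * ∫ y, nearK ((n : ℝ) + 1) y * ψ (x - y) =
      (∫ x, φ x * ψ x) - ∫ x, φ x * ∫ y, tail ((n : ℝ) + 1) y * ψ (x - y) := by
    intro n
    have hR : (0 : ℝ) < (n : ℝ) + 1 := by positivity
    have hd := contDiff_convolution (continuous_nearK ((n : ℝ) + 1)) hψ hc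
    have hs := hasCompactSupport_convolution (hasCompactSupport_nearK hR) hc
    rw [← heq _ hd hs]
    have i1 : Integrable (fun x => φ x * ψ x) :=
      hloc.integrable_smul_right_of_hasCompactSupport hψ.continuous hc
    have i2 := hloc.integrable_smul_right_of_hasCompactSupport
      (contDiff_lap (contDiff_lap hd)).continuous (hasCompactSupport_lap (hasCompactSupport_lap hs))
    have i3 : Integrable (fun x => φ x * ∫ y, tail ((n : ℝ) + 1) y * ψ (x - y)) := by
      refine (i1.sub i2).congr (Eventually.of_forall fun x => ?_)
      simp only [Pi.sub_apply, smul_eq_mul]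
      rw [bilaplacian_nearK_convolution hR hψ hc]
      ring
    rw [← integral_sub i1 i3]
    refine integral_congr_ae (Eventually.of_forall fun x => ?_)
    simp only
    rw [bilaplacian_nearK_convolution hR hψ hc]
    ring
  simp only [h] at t2
  have t3 := (tendsto_const_nhds (x := ∫ x, φ x * ψ x)).sub t1
  rw [sub_zero] at t3
  rw [tendsto_nhds_unique t3 t2, integral_convG_mul hw hψ.continuous hc]

/-- Smooth complex functions with compact support. -/
def testFunctions : Submodule ℂ (Plane → ℂ) where
  carrier := {ψ | ContDiff ℝ ∞ ψ ∧ HasCompactSupport ψ}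
  zero_mem' := ⟨contDiff_const, HasCompactSupport.zero⟩
  add_mem' := fun h g => ⟨h.1.add g.1, h.2.add g.2⟩
  smul_mem' := fun c _ h => ⟨contDiff_const.smul h.1, h.2.smul_left (f := fun _ => c)⟩

/-- The distribution attached to a locally integrable function. -/
noncomputable def pairing (h : Plane → ℂ) (hh : LocallyIntegrable h) : testFunctions →ₗ[ℂ] ℂ where
  toFun ψ := ∫ x, h x * (ψ : Plane → ℂ) x
  map_add' := by
    intro ψ χ
    have i1 : Integrable (fun x => h x * (ψ : Plane → ℂ) x) :=
      hh.integrable_smul_right_of_hasCompactSupport ψ.2.1.continuous ψ.2.2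
    have i2 : Integrable (fun x => h x * (χ : Plane → ℂ) x) :=
      hh.integrable_smul_right_of_hasCompactSupport χ.2.1.continuous χ.2.2
    rw [← integral_add i1 i2]
    refine integral_congr_ae (Eventually.of_forall fun x => ?_)
    simp [mul_add]
  map_smul' := by
    intro c ψ
    rw [RingHom.id_apply, smul_eq_mul, ← integral_const_mul]
    refine integral_congr_ae (Eventually.of_forall fun x => ?_)
    simp only [Submodule.coe_smul, Pi.smul_apply, smul_eq_mul]
    ring

lemma locallyIntegrable_mono (i : Fin 3) : LocallyIntegrable (fun x => (mono i x : ℂ)) :=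
  (Complex.continuous_ofReal.comp (continuous_mono i)).locallyIntegrable

/-- A function that annihilates all test functions with vanishing first moments is affine. -/
lemma exists_ae_eq_sum_mono {h : Plane → ℂ} (hh : LocallyIntegrable h)
    (h0 : ∀ ψ : Plane → ℂ, ContDiff ℝ ∞ ψ → HasCompactSupport ψ →
      (∀ i, ∫ x, (mono i x : ℂ) * ψ x = 0) → ∫ x, h x * ψ x = 0) :
    ∃ c : Fin 3 → ℂ, h =ᵐ[volume] fun x => ∑ i, c i * (mono i x : ℂ) := by
  have hspan : pairing h hh ∈ Submodule.span ℂ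
      (Set.range fun i => pairing _ (locallyIntegrable_mono i)) := by
    refine mem_span_of_iInf_ker_le_ker fun ψ hψ => ?_
    simp only [Submodule.mem_iInf, LinearMap.mem_ker] at hψ ⊢
    exact h0 ψ ψ.2.1 ψ.2.2 hψ
  obtain ⟨c, hc⟩ := (Submodule.mem_span_range_iff_exists_fun ℂ).1 hspan
  refine ⟨c, ?_⟩
  have hcont : Continuous (fun x => ∑ i, c i * (mono i x : ℂ)) :=
    continuous_finsetSum _ fun i _ =>
      continuous_const.mul (Complex.continuous_ofReal.comp (continuous_mono i))
  refine ae_eq_of_integral_contDiff_smul_eq hh hcont.locallyIntegrable fun g hg hgc => ?_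
  have hgs : HasCompactSupport (fun x => (g x : ℂ)) := hgc.comp_left Complex.ofReal_zero
  have h1 := LinearMap.congr_fun hc
    ⟨fun x => (g x : ℂ), Complex.ofRealCLM.contDiff.comp hg, hgs⟩
  simp only [LinearMap.sum_apply, LinearMap.smul_apply, smul_eq_mul] at h1
  have h2 : ∀ f : Plane → ℂ, ∫ x, g x • f x = ∫ x, f x * (g x : ℂ) := fun f => by
    refine integral_congr_ae (Eventually.of_forall fun x => ?_)
    simp only [Complex.real_smul]
    ring
  rw [h2, h2]
  refine h1.symm.trans ?_
  have h3 : ∀ i, Integrable (fun x => c i * (mono i x : ℂ) * (g x : ℂ)) := fun i =>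
    ((continuous_const.mul (Complex.continuous_ofReal.comp (continuous_mono i))).mul
      (Complex.continuous_ofReal.comp hg.continuous)).integrable_of_hasCompactSupport
        hgs.mul_left
  simp only [Finset.sum_mul]
  rw [integral_finsetSum _ fun i _ => h3 i]
  refine Finset.sum_congr rfl fun i _ => ?_
  simp only [mul_assoc]
  rw [integral_const_mul]
  rfl

/-- A Liouville type theorem: a distributional solution of `Δ² φ = w` of linear growth is
`G_{2,l} w` plus an affine function. -/
theorem exists_ae_eq_convG_add {φ w : Plane → ℂ} {C : ℝ}
    (hφm : AEStronglyMeasurable φ) (hφ : ∀ᵐ x : Plane, ‖φ x‖ ≤ C * jap x)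
    (hw : Integrable (fun x => ((1 + ‖x‖) ^ 3 : ℝ) * w x))
    (heq : ∀ ψ : Plane → ℂ, ContDiff ℝ ∞ ψ → HasCompactSupport ψ →
      ∫ x, φ x * Laplacian.laplacian (Laplacian.laplacian ψ) x = ∫ x, w x * ψ x) :
    ∃ c : Fin 3 → ℂ, φ =ᵐ[volume] fun x => convG w x + ∑ i, c i * (mono i x : ℂ) := by
  have hcont : Continuous (fun x : Plane => C * jap x) := continuous_const.mul continuous_jap
  have hloc : LocallyIntegrable φ := hcont.locallyIntegrable.mono hφm
    (by filter_upwards [hφ] with x hx using hx.trans (le_abs_self _))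
  have hG := locallyIntegrable_convG hw
  obtain ⟨c, hc⟩ := exists_ae_eq_sum_mono (hloc.sub hG) fun ψ hψ hψc hm => by
    have i1 : Integrable (fun x => φ x * ψ x) :=
      hloc.integrable_smul_right_of_hasCompactSupport hψ.continuous hψc
    have i2 : Integrable (fun x => convG w x * ψ x) :=
      hG.integrable_smul_right_of_hasCompactSupport hψ.continuous hψc
    simp only [Pi.sub_apply, sub_mul]
    rw [integral_sub i1 i2, integral_mul_eq_integral_convG_mul hφm hφ hw heq hψ hψc hm, sub_self]
  refine ⟨c, ?_⟩
  filter_upwards [hc] with x hx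
  rw [← hx, Pi.sub_apply]
  ring

/-! ### Compactness of `opG` and the Fredholm alternative -/

instance : Fact ((2 : ℝ≥0∞) ≠ ⊤) := ⟨ENNReal.ofNat_ne_top⟩

lemma exists_weakly_convergent_subseq {f : ℕ → L2} {r : ℝ} (hf : ∀ n, ‖f n‖ ≤ r) :
    ∃ g : L2, ‖g‖ ≤ r ∧ ∃ s : ℕ → ℕ, StrictMono s ∧
      ∀ k : L2, Tendsto (fun n => inner ℂ k (f (s n))) atTop (𝓝 (inner ℂ k g)) := by
  have hb : ∀ n, StrongDual.toWeakDual (toDual ℂ L2 (f n)) ∈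
      WeakDual.toStrongDual ⁻¹' Metric.closedBall (0 : StrongDual ℂ L2) r := by
    intro n
    rw [Set.mem_preimage, mem_closedBall_zero_iff]
    exact (LinearIsometryEquiv.norm_map (toDual ℂ L2) (f n)).trans_le (hf n)
  obtain ⟨F, hF, s, hs, hlim⟩ := WeakDual.isSeqCompact_closedBall ℂ L2 0 r hb
  refine ⟨(toDual ℂ L2).symm (WeakDual.toStrongDual F), ?_, s, hs, fun k => ?_⟩
  · rw [LinearIsometryEquiv.norm_map]
    simpa using hF
  · have h1 := ((WeakDual.eval_continuous k).tendsto F).comp hlim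
    have h2 : F k = inner ℂ ((toDual ℂ L2).symm (WeakDual.toStrongDual F)) k :=
      (toDual_symm_apply (x := k) (y := WeakDual.toStrongDual F)).symm
    have h3 := (Complex.continuous_conj.tendsto _).comp h1
    rw [h2, inner_conj_symm] at h3
    refine h3.congr fun n => ?_
    exact inner_conj_symm (𝕜 := ℂ) k (f (s n))

/-- Dominated convergence in `L²`. -/
lemma tendsto_zero_of_dominated {h : ℕ → L2} {b : Plane → ℝ} (hb : MemLp b 2)
    (hd : ∀ n, ∀ᵐ x, ‖h n x‖ ≤ b x) (hl : ∀ᵐ x, Tendsto (fun n => h n x) atTop (𝓝 0)) :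
    Tendsto h atTop (𝓝 0) := by
  have h1 : Tendsto (fun n => inner ℂ (h n) (h n)) atTop (𝓝 (∫ _ : Plane, (0 : ℂ))) := by
    simp only [L2.inner_def]
    refine tendsto_integral_of_dominated_convergence (fun x => b x ^ 2) ?_ hb.integrable_sq ?_ ?_
    · intro n
      exact (Lp.aestronglyMeasurable (h n)).inner (𝕜 := ℂ) (Lp.aestronglyMeasurable (h n))
    · intro n
      filter_upwards [hd n] with x hx
      rw [inner_self_eq_norm_sq_to_K]
      simp only [norm_pow]
      refine pow_le_pow_left₀ (norm_nonneg _) ?_ 2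
      simpa using hx
    · filter_upwards [hl] with x hx
      simpa using hx.inner (𝕜 := ℂ) hx
  rw [integral_zero] at h1
  have h2 : Tendsto (fun n => ‖h n‖ ^ 2) atTop (𝓝 0) := by
    have := h1.norm
    rw [norm_zero] at this
    refine this.congr fun n => ?_
    rw [inner_self_eq_norm_sq_to_K]
    simp
  rw [tendsto_zero_iff_norm_tendsto_zero]
  have h3 := (Real.continuous_sqrt.tendsto 0).comp h2
  rw [Real.sqrt_zero] at h3
  exact h3.congr fun n => Real.sqrt_sq (norm_nonneg _)

variable {V : Plane → ℝ}

lemma opU_ae (hV : Admissible V) (f : L2) : opU hV f =ᵐ[volume] fun x => (sgn V x : ℂ) * f x :=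
  (hV.memLp_sgn_mul f).coeFn_toLp

lemma opG_ae (hV : Admissible V) (f : L2) : opG hV f =ᵐ[volume] sandwich V f :=
  (hV.memLp_sandwich f).coeFn_toLp

lemma monoV_ae (hV : Admissible V) (i : Fin 3) :
    monoV hV i =ᵐ[volume] fun x => ((mono i x * rt V x : ℝ) : ℂ) :=
  (hV.memLp_mono_rt i).coeFn_toLp

lemma exists_sandwich_eq_inner (hV : Admissible V) (x : Plane) :
    ∃ k : L2, ∀ f : L2, sandwich V f x = inner ℂ k f := by
  have hk : MemLp (fun y => ((rt V x * (kerG (x - y) * rt V y) : ℝ) : ℂ)) 2 volume := by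
    refine hV.memLp_wt.of_le_mul (c := rt V x * (1 + ‖x‖) ^ 3) ?_ (Eventually.of_forall fun y => ?_)
    · exact Complex.continuous_ofReal.comp_aestronglyMeasurable (aestronglyMeasurable_const.mul
        ((continuous_kerG.comp (continuous_const.sub continuous_id)).aestronglyMeasurable.mul
          hV.aesm_rt))
    · rw [Complex.norm_real, norm_mul, norm_mul, Real.norm_of_nonneg (rt_nonneg x),
        Real.norm_of_nonneg (rt_nonneg y), Real.norm_of_nonneg (wt_nonneg y), wt, Real.norm_eq_abs]
      calc rt V x * (|kerG (x - y)| * rt V y)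
          ≤ rt V x * ((1 + ‖x‖) ^ 3 * (1 + ‖y‖) ^ 3 * rt V y) := by
            have := rt_nonneg (V := V) x
            have := rt_nonneg (V := V) y
            have := abs_kerG_le x y
            gcongr
        _ = _ := by ring
  refine ⟨hk.toLp _, fun f => ?_⟩
  rw [L2.inner_def, sandwich, convG, ← integral_const_mul]
  refine integral_congr_ae ?_
  filter_upwards [hk.coeFn_toLp] with y hy
  rw [hy, RCLike.inner_apply, Complex.conj_ofReal]
  push_cast
  ring

/-- `opG` turns weak convergence into pointwise convergence, and its values on the unit ball are
dominated by a multiple of the weight `wt V`; hence it turns weak into strong convergence. -/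
lemma isCompactOperator_opG (hV : Admissible V) : IsCompactOperator (opG hV) := by
  refine (isCompactOperator_iff_image_closedBall_subset_compact (opG hV).toLinearMap
    one_pos).2 ⟨opG hV '' Metric.closedBall 0 1, ?_, subset_rfl⟩
  refine IsSeqCompact.isCompact fun y hy => ?_
  choose f hf hfy using hy
  have hf1 : ∀ n, ‖f n‖ ≤ 1 := fun n => mem_closedBall_zero_iff.1 (hf n)
  obtain ⟨g, hg, s, hs, hlim⟩ := exists_weakly_convergent_subseq hf1
  refine ⟨opG hV g, ⟨g, mem_closedBall_zero_iff.2 hg, rfl⟩, s, hs, ?_⟩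
  have hd : Tendsto (fun n => opG hV (f (s n)) - opG hV g) atTop (𝓝 0) := by
    refine tendsto_zero_of_dominated
      (hV.memLp_wt.const_mul (2 * ‖hV.memLp_wt.toLp (wt V)‖)) (fun n => ?_) ?_
    · filter_upwards [Lp.coeFn_sub (opG hV (f (s n))) (opG hV g), opG_ae hV (f (s n)),
        opG_ae hV g] with x h1 h2 h3
      rw [h1, Pi.sub_apply, h2, h3]
      have b : ∀ u : L2, ‖u‖ ≤ 1 → ‖sandwich V u x‖ ≤ ‖hV.memLp_wt.toLp (wt V)‖ * wt V x := by
        intro u hu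
        refine (hV.norm_sandwich_le u x).trans ?_
        refine mul_le_mul_of_nonneg_right ?_ (wt_nonneg x)
        exact mul_le_of_le_one_right (norm_nonneg _) hu
      refine (norm_sub_le _ _).trans ((add_le_add (b _ (hf1 _)) (b _ hg)).trans (le_of_eq ?_))
      ring
    · have h2 : ∀ᵐ x, ∀ n, opG hV (f (s n)) x = sandwich V (f (s n)) x :=
        ae_all_iff.2 fun n => opG_ae hV (f (s n))
      have h1 : ∀ᵐ x, ∀ n, (opG hV (f (s n)) - opG hV g : L2) x =
          opG hV (f (s n)) x - opG hV g x :=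
        ae_all_iff.2 fun n => Lp.coeFn_sub _ _
      filter_upwards [h1, h2, opG_ae hV g] with x h1 h2 h3
      obtain ⟨k, hk⟩ := exists_sandwich_eq_inner hV x
      simp only [h1, h2, h3, hk]
      simpa using (hlim k).sub_const (inner ℂ k g)
  have h4 := hd.add_const (opG hV g)
  simp only [sub_add_cancel, zero_add] at h4
  exact h4.congr fun n => hfy (s n)

lemma sgn_mul_self (x : Plane) : sgn V x * sgn V x = 1 := by
  unfold sgn
  split_ifs <;> norm_num

lemma opU_opU (hV : Admissible V) (f : L2) : opU hV (opU hV f) = f := by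
  refine Lp.ext ?_
  filter_upwards [opU_ae hV (opU hV f), opU_ae hV f] with x h1 h2
  rw [h1, h2, ← mul_assoc, ← Complex.ofReal_mul, sgn_mul_self, Complex.ofReal_one, one_mul]

instance (hV : Admissible V) : FiniteDimensional ℂ (Submodule.span ℂ (Set.range (monoV hV))) :=
  FiniteDimensional.span_of_finite ℂ (Set.finite_range _)

instance (hV : Admissible V) : CompleteSpace (S0 hV) :=
  (Submodule.isClosed_orthogonal _).completeSpace_coe

/-- Fredholm alternative for the compression of `U + G` to the orthogonal complement of a finite
dimensional space `W`, where `U` is an involution and `G` is compact. With `Q` the projection onto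
`W`, the operator `(1 - Q) (U + G) (1 - Q) + Q` differs from `U` by a compact operator. -/
lemma surjective_compression_of_injective {E : Type*} [NormedAddCommGroup E]
    [InnerProductSpace ℂ E] [CompleteSpace E] {U G : E →L[ℂ] E} (hU : ∀ f, U (U f) = f)
    (hG : IsCompactOperator G) (W : Submodule ℂ E) [FiniteDimensional ℂ W]
    (hinj : ∀ f ∈ Wᗮ, Wᗮ.starProjection ((U + G) f) = 0 → f = 0) (g : E) (hg : g ∈ Wᗮ) :
    ∃ f ∈ Wᗮ, Wᗮ.starProjection ((U + G) f) = g := by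
  set Q : E →L[ℂ] E := W.starProjection with hQ
  have hmem : ∀ u, u ∈ Wᗮ ↔ Q u = 0 := fun u => (W.starProjection_apply_eq_zero_iff (v := u)).symm
  have hP : ∀ u, Wᗮ.starProjection u = u - Q u := fun u => Submodule.starProjection_orthogonal_val u
  have hQQ : ∀ u, Q (Q u) = Q u := fun u =>
    Submodule.starProjection_eq_self_iff.2 (Submodule.starProjection_apply_mem W u)
  have hQc : IsCompactOperator Q := by
    have h1 : IsCompactOperator (id : W → W) :=
      (isCompactOperator_id_iff_finiteDimensional (𝕜 := ℂ)).2 inferInstance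
    exact (h1.comp_clm W.orthogonalProjectionOnto).clm_comp W.subtypeL
  set T := U + G with hT
  set K : E →L[ℂ] E := G - Q ∘L T - (1 - Q) ∘L T ∘L Q + Q with hK
  have hKc : IsCompactOperator K := by
    have h := ((hG.sub (hQc.comp_clm T)).sub ((hQc.clm_comp T).clm_comp (1 - Q))).add hQc
    have hKe : (K : E → E) = ⇑G - ⇑Q ∘ ⇑T - ⇑(1 - Q) ∘ ⇑T ∘ ⇑Q + ⇑Q := by
      ext f
      simp [hK]
    rwa [hKe]
  have hA : ∀ f, U f + K f = (T (f - Q f) - Q (T (f - Q f))) + Q f := by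
    intro f
    have hTf : ∀ u, T u = U u + G u := fun u => rfl
    have hKf : K f = G f - Q (T f) - (T (Q f) - Q (T (Q f))) + Q f := rfl
    rw [hKf, map_sub, map_sub, hTf f]
    abel
  have hUKc : IsCompactOperator (U ∘L K) := hKc.clm_comp U
  have hAinj : ∀ f, U f + K f = 0 → f = 0 := by
    intro f hf
    rw [hA] at hf
    have hQf : Q f = 0 := by
      have := congrArg Q hf
      rwa [map_add, map_sub, hQQ, hQQ, sub_self, zero_add, map_zero] at this
    rw [hQf, sub_zero, add_zero, ← hP] at hf
    exact hinj f ((hmem f).2 hQf) hf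
  have hres : (-1 : ℂ) ∈ resolventSet ℂ (U ∘L K) := by
    refine (hUKc.hasEigenvalue_or_mem_resolventSet (by norm_num : (-1 : ℂ) ≠ 0)).resolve_left ?_
    intro hev
    obtain ⟨f, hf⟩ := hev.exists_hasEigenvector
    refine hf.2 (hAinj f ?_)
    have h1 : U (K f) = -f := by
      have := hf.apply_eq_smul
      rw [neg_one_smul] at this
      exact this
    have h2 := congrArg U h1
    rw [hU, map_neg] at h2
    rw [h2, add_neg_cancel]
  rw [spectrum.mem_resolventSet_iff, ContinuousLinearMap.isUnit_iff_bijective] at hres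
  obtain ⟨f, hf⟩ := hres.2 (-(U g))
  have h1 : -f - U (K f) = -(U g) := by
    rw [← hf]
    simp
  have h2 : U f + K f = g := by
    have := congrArg (fun u => U (-u)) h1
    simp only [neg_sub, sub_neg_eq_add, neg_neg, map_add, hU] at this
    rwa [add_comm]
  rw [hA] at h2
  have hQf : Q f = 0 := by
    have := congrArg Q h2
    rwa [map_add, map_sub, hQQ, hQQ, sub_self, zero_add, (hmem g).1 hg] at this
  refine ⟨f, (hmem f).2 hQf, ?_⟩
  rw [hQf, sub_zero, add_zero] at h2
  rw [hP, h2]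

lemma coe_compT (hV : Admissible V) (f : S0 hV) :
    (compT hV f : L2) = (S0 hV).starProjection (opT hV f) := rfl

theorem isUnit_compT_iff (hV : Admissible V) :
    IsUnit (compT hV) ↔ LinearMap.ker (compT hV).toLinearMap = ⊥ := by
  rw [ContinuousLinearMap.isUnit_iff_bijective]
  refine ⟨fun h => LinearMap.ker_eq_bot.2 h.1, fun h => ?_⟩
  have hinj : Function.Injective (compT hV) := LinearMap.ker_eq_bot.1 h
  refine ⟨hinj, fun g => ?_⟩
  obtain ⟨f, hf, hfg⟩ := surjective_compression_of_injective (opU_opU hV)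
    (isCompactOperator_opG hV) (Submodule.span ℂ (Set.range (monoV hV)))
    (fun f hf h0 => by
      have h1 : compT hV ⟨f, hf⟩ = 0 := Subtype.ext h0
      exact congrArg Subtype.val (hinj (h1.trans (map_zero _).symm))) g g.2
  exact ⟨⟨f, hf⟩, Subtype.ext hfg⟩

/-! ### Asymptotics of the potential at infinity -/

lemma abs_mul_log_le {s : ℝ} (hs : 0 ≤ s) : |s * Real.log s| ≤ |s - 1| + (s - 1) ^ 2 := by
  rcases hs.eq_or_lt with h0 | h0
  · simp [← h0]
  have h1 := Real.log_le_sub_one_of_pos h0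
  have h2 := Real.one_sub_inv_le_log_of_pos h0
  have h3 : s - 1 ≤ s * Real.log s := by
    have := mul_le_mul_of_nonneg_left h2 hs
    rwa [mul_sub, mul_one, mul_inv_cancel₀ h0.ne'] at this
  have h4 : s * Real.log s ≤ (s - 1) + (s - 1) ^ 2 := by nlinarith
  rw [abs_le]
  constructor
  · nlinarith [neg_abs_le (s - 1), sq_nonneg (s - 1)]
  · linarith [le_abs_self (s - 1)]

/-- Away from the origin the kernel is affine in `y` up to an error of linear growth in `x`. With
`s = |x - y|² / |x|²` one has
`|x - y|² log |x - y| = |x|² s log s / 2 + |x - y|² log |x|`, and `s log s` is comparable to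
`s - 1`. -/
lemma abs_kerG_sub_le {x : Plane} (hx : 1 ≤ ‖x‖) (y : Plane) :
    |8 * Real.pi * kerG (x - y) - Real.log ‖x‖ * (‖x‖ ^ 2 - 2 * inner ℝ x y)| ≤
      2 * ‖x‖ * (1 + ‖y‖) ^ 4 := by
  have hx0 : 0 < ‖x‖ := by linarith
  set s := ‖x - y‖ ^ 2 / ‖x‖ ^ 2 with hs
  set a := ‖y‖ ^ 2 + 2 * ‖y‖ with ha
  have hy := norm_nonneg y
  have hsq : ‖x - y‖ ^ 2 = ‖x‖ ^ 2 - 2 * inner ℝ x y + ‖y‖ ^ 2 := norm_sub_sq_real x y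
  have hker : 8 * Real.pi * kerG (x - y) = ‖x‖ ^ 2 / 2 * (s * Real.log s) +
      ‖x - y‖ ^ 2 * Real.log ‖x‖ := by
    have hpi := Real.pi_ne_zero
    rcases eq_or_ne ‖x - y‖ 0 with h0 | h0
    · simp [kerG, hs, h0]
    · rw [kerG, hs, Real.log_div (by positivity) (by positivity), Real.log_pow, Real.log_pow]
      push_cast
      field_simp
      ring
  have hin : |inner ℝ x y| ≤ ‖x‖ * ‖y‖ := abs_real_inner_le_norm x y
  have hs1 : |s - 1| ≤ a / ‖x‖ := by
    have e : s - 1 = (‖y‖ ^ 2 - 2 * inner ℝ x y) / ‖x‖ ^ 2 := by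
      rw [hs, hsq]
      field_simp
      ring
    rw [e, abs_div, abs_of_pos (by positivity : 0 < ‖x‖ ^ 2),
      div_le_div_iff₀ (by positivity) hx0]
    have h1 : |‖y‖ ^ 2 - 2 * inner ℝ x y| ≤ ‖x‖ * a := by
      obtain ⟨h3, h4⟩ := abs_le.1 hin
      rw [abs_le, ha]
      constructor <;> nlinarith [sq_nonneg ‖y‖]
    nlinarith
  have hsl : |‖x‖ ^ 2 / 2 * (s * Real.log s)| ≤ ‖x‖ / 2 * a + a ^ 2 / 2 := by
    rw [abs_mul, abs_of_nonneg (by positivity : 0 ≤ ‖x‖ ^ 2 / 2)]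
    have h2 : (s - 1) ^ 2 ≤ (a / ‖x‖) ^ 2 := by
      rw [← sq_abs]
      exact pow_le_pow_left₀ (abs_nonneg _) hs1 2
    calc ‖x‖ ^ 2 / 2 * |s * Real.log s|
        ≤ ‖x‖ ^ 2 / 2 * (a / ‖x‖ + (a / ‖x‖) ^ 2) := by
          refine mul_le_mul_of_nonneg_left ?_ (by positivity)
          exact (abs_mul_log_le (by positivity)).trans (add_le_add hs1 h2)
      _ = ‖x‖ / 2 * a + a ^ 2 / 2 := by field_simp
  have hlog0 : 0 ≤ Real.log ‖x‖ := Real.log_nonneg hx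
  have hlog : Real.log ‖x‖ ≤ ‖x‖ := by
    have := Real.log_le_sub_one_of_pos hx0
    linarith
  have hmain : 8 * Real.pi * kerG (x - y) - Real.log ‖x‖ * (‖x‖ ^ 2 - 2 * inner ℝ x y) =
      ‖x‖ ^ 2 / 2 * (s * Real.log s) + ‖y‖ ^ 2 * Real.log ‖x‖ := by
    rw [hker, hsq]
    ring
  rw [hmain]
  have h5 : |‖y‖ ^ 2 * Real.log ‖x‖| ≤ ‖y‖ ^ 2 * ‖x‖ := by
    rw [abs_of_nonneg (by positivity)]
    gcongr
  refine (abs_add_le _ _).trans ((add_le_add hsl h5).trans ?_)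
  have ha1 : a ≤ (1 + ‖y‖) ^ 2 := by rw [ha]; nlinarith
  have ha0 : 0 ≤ a := by positivity
  have h6 : a ^ 2 ≤ (1 + ‖y‖) ^ 4 := by
    calc a ^ 2 ≤ ((1 + ‖y‖) ^ 2) ^ 2 := pow_le_pow_left₀ ha0 ha1 2
      _ = _ := by ring
  have h7 : (1 + ‖y‖) ^ 2 ≤ (1 + ‖y‖) ^ 4 :=
    pow_le_pow_right₀ (by linarith) (by norm_num)
  have h8 : ‖y‖ ^ 2 ≤ (1 + ‖y‖) ^ 4 := by nlinarith
  calc ‖x‖ / 2 * a + a ^ 2 / 2 + ‖y‖ ^ 2 * ‖x‖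
      ≤ ‖x‖ / 2 * (1 + ‖y‖) ^ 4 + ‖x‖ * (1 + ‖y‖) ^ 4 / 2 + (1 + ‖y‖) ^ 4 * ‖x‖ := by
        have h9 : a ^ 2 ≤ ‖x‖ * (1 + ‖y‖) ^ 4 := by nlinarith [sq_nonneg a]
        have h10 : a ≤ (1 + ‖y‖) ^ 4 := ha1.trans h7
        gcongr
    _ = _ := by ring

lemma abs_mono_le (i : Fin 3) (x : Plane) : |mono i x| ≤ 1 + ‖x‖ := by
  have h := fun j => PiLp.norm_apply_le x j
  simp only [Real.norm_eq_abs] at h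
  fin_cases i
  · simp [mono]
  · simpa [mono] using (h 0).trans (by linarith)
  · simpa [mono] using (h 1).trans (by linarith)

lemma integrable_weight_mul_of_le {w : Plane → ℂ}
    (hw : Integrable (fun x => ((1 + ‖x‖) ^ 4 : ℝ) * w x)) (hm : AEStronglyMeasurable w)
    {p : Plane → ℝ} (hp : Continuous p) (hb : ∀ x, |p x| ≤ (1 + ‖x‖) ^ 4) :
    Integrable (fun x => (p x : ℂ) * w x) := by
  refine hw.mono ((Complex.continuous_ofReal.comp hp).aestronglyMeasurable.mul hm)
    (Eventually.of_forall fun x => ?_)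
  rw [norm_mul, norm_mul, Complex.norm_real, Complex.norm_real, Real.norm_eq_abs,
    Real.norm_of_nonneg (by positivity : 0 ≤ (1 + ‖x‖) ^ 4)]
  exact mul_le_mul_of_nonneg_right (hb x) (norm_nonneg _)

lemma integrable_mono_mul {w : Plane → ℂ}
    (hw : Integrable (fun x => ((1 + ‖x‖) ^ 4 : ℝ) * w x)) (hm : AEStronglyMeasurable w)
    (i : Fin 3) : Integrable (fun x => (mono i x : ℂ) * w x) :=
  integrable_weight_mul_of_le hw hm (continuous_mono i) fun x =>
    (abs_mono_le i x).trans (le_self_pow₀ (by linarith [norm_nonneg x]) (by norm_num))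

lemma integrable_weight_three {w : Plane → ℂ}
    (hw : Integrable (fun x => ((1 + ‖x‖) ^ 4 : ℝ) * w x)) (hm : AEStronglyMeasurable w) :
    Integrable (fun x => ((1 + ‖x‖) ^ 3 : ℝ) * w x) :=
  integrable_weight_mul_of_le hw hm (p := fun x => (1 + ‖x‖) ^ 3) (by fun_prop) fun x => by
    rw [abs_of_nonneg (by positivity)]
    exact pow_le_pow_right₀ (by linarith [norm_nonneg x]) (by norm_num)

/-- The potential at infinity is governed by the moments of order at most one. -/
lemma norm_convG_sub_le {w : Plane → ℂ}
    (hw : Integrable (fun x => ((1 + ‖x‖) ^ 4 : ℝ) * w x)) (hm : AEStronglyMeasurable w)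
    {x : Plane} (hx : 1 ≤ ‖x‖) :
    ‖((8 * Real.pi : ℝ) : ℂ) * convG w x - (Real.log ‖x‖ : ℂ) *
      ((‖x‖ ^ 2 : ℝ) * (∫ y, (mono 0 y : ℂ) * w y) -
        2 * ((x 0 : ℂ) * (∫ y, (mono 1 y : ℂ) * w y) +
          (x 1 : ℂ) * ∫ y, (mono 2 y : ℂ) * w y))‖ ≤
      2 * (∫ y, ‖((1 + ‖y‖) ^ 4 : ℝ) * w y‖) * ‖x‖ := by
  have i0 := integrable_mono_mul hw hm
  have iK := integrable_kerG_mul (integrable_weight_three hw hm) hm x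
  have i12 : Integrable (fun y => (x 0 : ℂ) * ((mono 1 y : ℂ) * w y) +
      (x 1 : ℂ) * ((mono 2 y : ℂ) * w y)) := ((i0 1).const_mul _).add ((i0 2).const_mul _)
  have iall : Integrable (fun y => (‖x‖ ^ 2 : ℝ) * ((mono 0 y : ℂ) * w y) -
      2 * ((x 0 : ℂ) * ((mono 1 y : ℂ) * w y) + (x 1 : ℂ) * ((mono 2 y : ℂ) * w y))) :=
    ((i0 0).const_mul _).sub (i12.const_mul 2)
  have e : ((8 * Real.pi : ℝ) : ℂ) * convG w x - (Real.log ‖x‖ : ℂ) *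
      ((‖x‖ ^ 2 : ℝ) * (∫ y, (mono 0 y : ℂ) * w y) -
        2 * ((x 0 : ℂ) * (∫ y, (mono 1 y : ℂ) * w y) +
          (x 1 : ℂ) * ∫ y, (mono 2 y : ℂ) * w y)) =
      ∫ y, ((8 * Real.pi * kerG (x - y) - Real.log ‖x‖ * (‖x‖ ^ 2 - 2 * inner ℝ x y) : ℝ) : ℂ) *
        w y := by
    rw [convG, ← integral_const_mul, ← integral_const_mul (x 0 : ℂ),
      ← integral_const_mul (x 1 : ℂ), ← integral_add ((i0 1).const_mul _) ((i0 2).const_mul _),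
      ← integral_const_mul (2 : ℂ), ← integral_const_mul ((‖x‖ ^ 2 : ℝ) : ℂ),
      ← integral_sub ((i0 0).const_mul _) (i12.const_mul 2), ← integral_const_mul,
      ← integral_sub (iK.const_mul _) (iall.const_mul _)]
    refine integral_congr_ae (Eventually.of_forall fun y => ?_)
    have hin : inner ℝ x y = x 0 * y 0 + x 1 * y 1 := by
      rw [PiLp.inner_apply, Fin.sum_univ_two]
      simp only [RCLike.inner_apply, conj_trivial]
      ring
    simp only [hin, mono, Matrix.cons_val_zero, Matrix.cons_val_one, Matrix.cons_val]
    push_cast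
    ring
  rw [e, mul_right_comm, ← integral_const_mul]
  refine norm_integral_le_of_norm_le (hw.norm.const_mul _) (Eventually.of_forall fun y => ?_)
  rw [norm_mul, norm_mul, Complex.norm_real, Complex.norm_real, Real.norm_eq_abs,
    Real.norm_of_nonneg (by positivity : 0 ≤ (1 + ‖y‖) ^ 4), ← mul_assoc]
  exact mul_le_mul_of_nonneg_right (abs_kerG_sub_le hx y) (norm_nonneg _)

lemma norm_le_jap (x : Plane) : ‖x‖ ≤ jap x := Real.le_sqrt_of_sq_le (by linarith)

/-- If the moments of order at most one vanish, the potential grows at most linearly. -/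
lemma exists_norm_convG_le {w : Plane → ℂ}
    (hw : Integrable (fun x => ((1 + ‖x‖) ^ 4 : ℝ) * w x)) (hm : AEStronglyMeasurable w)
    (h0 : ∀ i, ∫ y, (mono i y : ℂ) * w y = 0) :
    ∃ C : ℝ, ∀ x, ‖convG w x‖ ≤ C * jap x := by
  set M := ∫ y, ‖((1 + ‖y‖) ^ 4 : ℝ) * w y‖ with hM
  set N := ∫ y, ‖((1 + ‖y‖) ^ 3 : ℝ) * w y‖ with hN
  have hM0 : 0 ≤ M := integral_nonneg fun y => norm_nonneg _
  have hN0 : 0 ≤ N := integral_nonneg fun y => norm_nonneg _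
  refine ⟨8 * N + 2 * M, fun x => ?_⟩
  have hj := one_le_jap x
  have hn := norm_le_jap x
  rcases le_total ‖x‖ 1 with hx | hx
  · have h := norm_convG_le (integrable_weight_three hw hm) x
    have h2 : (1 + ‖x‖) ^ 3 ≤ 2 ^ 3 := pow_le_pow_left₀ (by positivity) (by linarith) 3
    calc ‖convG w x‖ ≤ N * (1 + ‖x‖) ^ 3 := h
      _ ≤ N * 2 ^ 3 := by gcongr
      _ ≤ 8 * N + 2 * M := by linarith
      _ ≤ _ := le_mul_of_one_le_right (by positivity) hj
  · have h := norm_convG_sub_le hw hm hx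
    simp only [h0, mul_zero, add_zero, sub_zero] at h
    rw [norm_mul, Complex.norm_real, Real.norm_of_nonneg (by positivity)] at h
    have hpi : 1 ≤ 8 * Real.pi := by linarith [Real.pi_gt_three]
    calc ‖convG w x‖ ≤ 8 * Real.pi * ‖convG w x‖ :=
          le_mul_of_one_le_left (norm_nonneg _) hpi
      _ ≤ 2 * M * ‖x‖ := h
      _ ≤ (8 * N + 2 * M) * jap x := by gcongr; linarith

/-- If the potential grows at most linearly up to an affine function, the moments of order at most
one vanish: along a coordinate axis `log t · ‖t m₀ - 2 mᵢ‖` has to stay bounded. -/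
lemma integral_mono_mul_eq_zero {w : Plane → ℂ}
    (hw : Integrable (fun x => ((1 + ‖x‖) ^ 4 : ℝ) * w x)) (hm : AEStronglyMeasurable w)
    {c : Fin 3 → ℂ} {C : ℝ}
    (hC : ∀ᵐ x : Plane, ‖convG w x + ∑ i, c i * (mono i x : ℂ)‖ ≤ C * jap x) (i : Fin 3) :
    ∫ y, (mono i y : ℂ) * w y = 0 := by
  set M := ∫ y, ‖((1 + ‖y‖) ^ 4 : ℝ) * w y‖ with hM
  set m : Fin 3 → ℂ := fun i => ∫ y, (mono i y : ℂ) * w y with hmdef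
  have hM0 : 0 ≤ M := integral_nonneg fun y => norm_nonneg _
  set S := ∑ i, ‖c i‖ with hS
  have hS0 : 0 ≤ S := Finset.sum_nonneg fun i _ => norm_nonneg _
  set D := 2 * M + 8 * Real.pi * (2 * |C| + 2 * S) with hD
  have hpi := Real.pi_pos
  have hD0 : 0 ≤ D := by positivity
  -- The cut-off `max 1 ‖x‖` makes the leading term continuous, and zero on the unit disc.
  set F : Plane → ℝ := fun x => ‖(Real.log (max 1 ‖x‖) : ℂ) *
      ((‖x‖ ^ 2 : ℝ) * m 0 - 2 * ((x 0 : ℂ) * m 1 + (x 1 : ℂ) * m 2))‖ with hF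
  have hFc : Continuous F := by
    have h1 : Continuous (fun x : Plane => Real.log (max 1 ‖x‖)) :=
      Continuous.log (by fun_prop) fun x => by positivity
    have h2 : Continuous (fun x : Plane => (Real.log (max 1 ‖x‖) : ℂ)) :=
      Complex.continuous_ofReal.comp h1
    exact (h2.mul (by fun_prop)).norm
  have hFae : ∀ᵐ x : Plane, F x ≤ D * ‖x‖ := by
    filter_upwards [hC] with x hx
    rcases le_total ‖x‖ 1 with h1 | h1
    · simp only [hF, max_eq_left h1, Real.log_one, Complex.ofReal_zero, zero_mul, norm_zero]
      positivity
    · simp only [hF, max_eq_right h1]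
      have h2 := norm_convG_sub_le hw hm h1
      have h3 : ‖∑ i, c i * (mono i x : ℂ)‖ ≤ 2 * S * ‖x‖ := by
        refine (norm_sum_le _ _).trans ?_
        rw [hS, Finset.mul_sum, Finset.sum_mul]
        refine Finset.sum_le_sum fun i _ => ?_
        rw [norm_mul, Complex.norm_real, Real.norm_eq_abs]
        have := abs_mono_le i x
        nlinarith [norm_nonneg (c i)]
      have h4 : ‖convG w x‖ ≤ (2 * |C| + 2 * S) * ‖x‖ := by
        have h5 : convG w x = (convG w x + ∑ i, c i * (mono i x : ℂ)) -
          ∑ i, c i * (mono i x : ℂ) := by ring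
        have h6 : C * jap x ≤ 2 * |C| * ‖x‖ := by
          have := jap_le x
          have := one_le_jap x
          nlinarith [le_abs_self C, abs_nonneg C]
        rw [h5]
        refine (norm_sub_le _ _).trans ?_
        linarith
      have h7 : ‖((8 * Real.pi : ℝ) : ℂ) * convG w x‖ ≤
          8 * Real.pi * ((2 * |C| + 2 * S) * ‖x‖) := by
        rw [norm_mul, Complex.norm_real, Real.norm_of_nonneg (by positivity)]
        gcongr
      have h8 := norm_le_norm_add_norm_sub (((8 * Real.pi : ℝ) : ℂ) * convG w x)
        ((Real.log ‖x‖ : ℂ) *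
          ((‖x‖ ^ 2 : ℝ) * m 0 - 2 * ((x 0 : ℂ) * m 1 + (x 1 : ℂ) * m 2)))
      refine h8.trans ?_
      rw [hD]
      linarith
  have hFall : ∀ x : Plane, F x ≤ D * ‖x‖ := by
    have h1 : (fun x => max (F x) (D * ‖x‖)) =ᵐ[volume] fun x : Plane => D * ‖x‖ := by
      filter_upwards [hFae] with x hx using max_eq_right hx
    have h2 := (Continuous.ae_eq_iff_eq volume (by fun_prop) (by fun_prop)).1 h1
    exact fun x => max_eq_right_iff.1 (congrFun h2 x)
  have haxis : ∀ j : Fin 2, Tendsto (fun n : ℕ => (n : ℂ) * m 0 - 2 * m j.succ) atTop (𝓝 0) := by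
    intro j
    have hlim : Tendsto (fun n : ℕ => D / Real.log n) atTop (𝓝 0) :=
      (Real.tendsto_log_atTop.comp tendsto_natCast_atTop_atTop).const_div_atTop D
    refine squeeze_zero_norm' ?_ hlim
    filter_upwards [eventually_gt_atTop 1] with n hn
    have hn1 : (1 : ℝ) < n := by exact_mod_cast hn
    have hlog := Real.log_pos hn1
    have h1 := hFall ((n : ℝ) • frame j)
    have hnorm : ‖(n : ℝ) • frame j‖ = n := by
      rw [norm_smul, OrthonormalBasis.norm_eq_one, mul_one, Real.norm_of_nonneg (by positivity)]
    have hval : (‖(n : ℝ) • frame j‖ ^ 2 : ℝ) * m 0 -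
        2 * (((((n : ℝ) • frame j) 0 : ℝ) : ℂ) * m 1 + ((((n : ℝ) • frame j) 1 : ℝ) : ℂ) * m 2) =
        (n : ℂ) * ((n : ℂ) * m 0 - 2 * m j.succ) := by
      rw [hnorm]
      fin_cases j <;> simp <;> ring
    simp only [hF] at h1
    rw [hval, hnorm, max_eq_right hn1.le, norm_mul, norm_mul, Complex.norm_real,
      Real.norm_of_nonneg hlog.le, Complex.norm_natCast] at h1
    rw [le_div_iff₀ hlog]
    have hn0 : (0 : ℝ) < n := by linarith
    nlinarith
  have hm0 : m 0 = 0 := by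
    have h1 := ((haxis 0).comp (tendsto_add_atTop_nat 1)).sub (haxis 0)
    rw [sub_zero] at h1
    refine tendsto_nhds_unique (tendsto_const_nhds.congr fun n => ?_) h1
    simp only [Function.comp_apply]
    push_cast
    ring
  have hmj : ∀ j : Fin 2, m j.succ = 0 := by
    intro j
    have h1 := haxis j
    simp only [hm0, mul_zero, zero_sub] at h1
    have h2 := tendsto_nhds_unique tendsto_const_nhds h1
    simpa using h2
  exact Fin.cases hm0 hmj i

/-! ### Densities `v f` with `f ∈ L²` -/

/-- The density `v f`. -/
noncomputable def density (V : Plane → ℝ) (f : Plane → ℂ) (x : Plane) : ℂ := (rt V x : ℂ) * f x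

lemma memLp_weight_four (hV : Admissible V) : MemLp (fun x => (1 + ‖x‖) ^ 4 * rt V x) 2 := by
  have hm : AEStronglyMeasurable (fun x => (1 + ‖x‖) ^ 4 * rt V x) volume :=
    (Continuous.aestronglyMeasurable (by fun_prop)).mul hV.aesm_rt
  rw [memLp_two_iff_integrable_sq hm]
  obtain ⟨ε, hε, h⟩ := hV.decay_cond
  refine (h.norm.const_mul 256).mono' (hm.pow 2) (Eventually.of_forall fun x => ?_)
  have h1 := one_le_jap x
  have h2 : (1 + ‖x‖) ^ 8 ≤ 256 * jap x ^ (10 + ε) := by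
    calc (1 + ‖x‖) ^ 8 ≤ (2 * jap x) ^ 8 :=
          pow_le_pow_left₀ (by positivity) (one_add_norm_le x) 8
      _ = 256 * jap x ^ ((8 : ℕ) : ℝ) := by
          rw [mul_pow, Real.rpow_natCast]
          norm_num
      _ ≤ 256 * jap x ^ (10 + ε) := by
          gcongr
          push_cast
          linarith
  have h3 : rt V x ^ 2 = |V x| := Real.sq_sqrt (abs_nonneg _)
  have h4 : 0 ≤ jap x ^ (10 + ε) := Real.rpow_nonneg (by linarith) _
  have h5 : ((1 + ‖x‖) ^ 4 * rt V x) ^ 2 = (1 + ‖x‖) ^ 8 * |V x| := by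
    rw [mul_pow, h3]
    ring
  rw [h5, Real.norm_of_nonneg (by positivity), norm_mul, Real.norm_of_nonneg h4,
    Real.norm_eq_abs, ← mul_assoc]
  exact mul_le_mul_of_nonneg_right h2 (abs_nonneg _)

lemma aestronglyMeasurable_density (hV : Admissible V) (f : L2) :
    AEStronglyMeasurable (density V f) :=
  (Complex.continuous_ofReal.comp_aestronglyMeasurable hV.aesm_rt).mul (Lp.aestronglyMeasurable f)

lemma integrable_density (hV : Admissible V) (f : L2) :
    Integrable (fun x => ((1 + ‖x‖) ^ 4 : ℝ) * density V f x) := by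
  have h := (memLp_weight_four hV).integrable_mul (Lp.memLp f).norm
  refine h.mono' ?_ (Eventually.of_forall fun x => ?_)
  · refine AEStronglyMeasurable.mul (Continuous.aestronglyMeasurable ?_)
      (aestronglyMeasurable_density hV f)
    exact Complex.continuous_ofReal.comp (by fun_prop)
  · rw [density, norm_mul, norm_mul, Complex.norm_real, Complex.norm_real,
      Real.norm_of_nonneg (by positivity), Real.norm_of_nonneg (rt_nonneg x), ← mul_assoc]
    exact le_rfl

lemma integrable_density_three (hV : Admissible V) (f : L2) :
    Integrable (fun x => ((1 + ‖x‖) ^ 3 : ℝ) * density V f x) :=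
  integrable_weight_three (integrable_density hV f) (aestronglyMeasurable_density hV f)

lemma inner_monoV (hV : Admissible V) (i : Fin 3) (f : L2) :
    inner ℂ (monoV hV i) f = ∫ y, (mono i y : ℂ) * density V f y := by
  rw [L2.inner_def]
  refine integral_congr_ae ?_
  filter_upwards [monoV_ae hV i] with y hy
  rw [hy, RCLike.inner_apply, Complex.conj_ofReal, density]
  push_cast
  ring

lemma sum_monoV_ae (hV : Admissible V) (c : Fin 3 → ℂ) :
    ((∑ i, c i • monoV hV i : L2) : Plane → ℂ) =ᵐ[volume]
      fun x => (rt V x : ℂ) * ∑ i, c i * (mono i x : ℂ) := by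
  have h1 : ∀ᵐ x, ∀ i, (c i • monoV hV i : L2) x = c i * ((mono i x * rt V x : ℝ) : ℂ) := by
    refine ae_all_iff.2 fun i => ?_
    filter_upwards [Lp.coeFn_smul (c i) (monoV hV i), monoV_ae hV i] with x h2 h3
    rw [h2, Pi.smul_apply, h3, smul_eq_mul]
  filter_upwards [Lp.coeFn_finsetSum Finset.univ (fun i => c i • monoV hV i), h1] with x h2 h3
  rw [h2, Finset.sum_apply, Finset.mul_sum]
  refine Finset.sum_congr rfl fun i _ => ?_
  rw [h3]
  push_cast
  ring

lemma opT_ae (hV : Admissible V) (f : L2) : opT hV f =ᵐ[volume] fun x =>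
    (sgn V x : ℂ) * f x + (rt V x : ℂ) * convG (density V f) x := by
  filter_upwards [Lp.coeFn_add (opU hV f) (opG hV f), opU_ae hV f, opG_ae hV f] with x h1 h2 h3
  rw [show opT hV f = opU hV f + opG hV f from rfl, h1, Pi.add_apply, h2, h3]
  rfl

/-- An affine function that is not identically zero vanishes only on a null set. -/
lemma eq_zero_of_sum_mono_eq_zero {c : Fin 3 → ℂ}
    (h : volume {x : Plane | ∑ i, c i * (mono i x : ℂ) = 0} ≠ 0) : c = 0 := by
  let s : AffineSubspace ℝ Plane :=
    { carrier := {x : Plane | ∑ i, c i * (mono i x : ℂ) = 0}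
      smul_vsub_vadd_mem' := by
        intro t p q r hp hq hr
        simp only [Set.mem_ofPred_eq, Fin.sum_univ_three, mono, Matrix.cons_val_zero,
          Matrix.cons_val_one, Matrix.cons_val, vsub_eq_sub, vadd_eq_add, PiLp.add_apply,
          PiLp.smul_apply, PiLp.sub_apply, smul_eq_mul] at hp hq hr ⊢
        push_cast at hp hq hr ⊢
        linear_combination (t : ℂ) * hp - (t : ℂ) * hq + hr }
  have hs : s = ⊤ := by
    by_contra hne
    exact h (Measure.addHaar_affineSubspace volume s hne)
  have hall : ∀ x : Plane, ∑ i, c i * (mono i x : ℂ) = 0 := fun x => by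
    have : x ∈ s := hs ▸ AffineSubspace.mem_top ℝ Plane x
    exact this
  simp only [Fin.sum_univ_three, mono, Matrix.cons_val_zero, Matrix.cons_val_one,
    Matrix.cons_val] at hall
  have h0 := hall 0
  have h1 := hall (frame 0)
  have h2 := hall (frame 1)
  simp at h0 h1 h2
  rw [h0, zero_add] at h1 h2
  funext i
  fin_cases i
  · exact h0
  · exact h1
  · exact h2

/-- The functions `v`, `x₁ v`, `x₂ v` are linearly independent unless `V` vanishes. -/
lemma eq_zero_of_sum_monoV_eq_zero (hV : Admissible V) (hV0 : ¬ V =ᵐ[volume] 0)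
    {c : Fin 3 → ℂ} (h : ∑ i, c i • monoV hV i = 0) : c = 0 := by
  refine eq_zero_of_sum_mono_eq_zero fun hnull => hV0 ?_
  have h1 := sum_monoV_ae hV c
  rw [h] at h1
  have h2 : ∀ᵐ x : Plane, ¬ ∑ i, c i * (mono i x : ℂ) = 0 := by
    rw [ae_iff]
    simpa using hnull
  filter_upwards [h1, h2, Lp.coeFn_zero ℂ 2 (volume : Measure Plane)] with x h3 h4 h5
  rw [h5, Pi.zero_apply] at h3
  have h6 := (mul_eq_zero.1 h3.symm).resolve_right h4
  have h7 : rt V x = 0 := by exact_mod_cast h6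
  rw [rt, Real.sqrt_eq_zero (abs_nonneg _)] at h7
  simpa using h7

lemma sgn_mul_rt_sq (x : Plane) : sgn V x * (rt V x * rt V x) = V x := by
  rw [rt, Real.mul_self_sqrt (abs_nonneg _), sgn]
  split_ifs with h
  · rw [one_mul, abs_of_nonneg h]
  · rw [abs_of_neg (not_le.1 h)]
    ring

/-! ### From the kernel of `S₀ T₀ S₀` to resonances -/

lemma contDiff_mono (i : Fin 3) : ContDiff ℝ ∞ (fun x => (mono i x : ℂ)) := by
  refine Complex.ofRealCLM.contDiff.comp ?_
  fin_cases i
  · exact contDiff_const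
  · exact (EuclideanSpace.proj (𝕜 := ℝ) (0 : Fin 2)).contDiff
  · exact (EuclideanSpace.proj (𝕜 := ℝ) (1 : Fin 2)).contDiff

lemma laplacian_mono (i : Fin 3) : Laplacian.laplacian (fun x => (mono i x : ℂ)) = 0 := by
  have hclm : ∀ L : Plane →L[ℝ] ℂ, Laplacian.laplacian (fun x => L x) = 0 := by
    intro L
    funext x
    rw [laplacian_eq_sum L.contDiff]
    simp
  fin_cases i
  · funext x
    simp [mono]
  · exact hclm (Complex.ofRealCLM.comp (EuclideanSpace.proj (𝕜 := ℝ) (0 : Fin 2)))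
  · exact hclm (Complex.ofRealCLM.comp (EuclideanSpace.proj (𝕜 := ℝ) (1 : Fin 2)))

lemma integral_mono_mul_bilaplacian (i : Fin 3) {ψ : Plane → ℂ} (hψ : ContDiff ℝ ∞ ψ)
    (hc : HasCompactSupport ψ) :
    ∫ x, (mono i x : ℂ) * Laplacian.laplacian (Laplacian.laplacian ψ) x = 0 := by
  rw [integral_mul_laplacian (contDiff_mono i) (contDiff_lap hψ) (hasCompactSupport_lap hc),
    laplacian_mono]
  simp

/-- The function `G_{2,l} (v f) - (c₀ + c₁ x₁ + c₂ x₂)`. -/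
noncomputable def resonance (V : Plane → ℝ) (f : Plane → ℂ) (c : Fin 3 → ℂ) (x : Plane) : ℂ :=
  convG (density V f) x - ∑ i, c i * (mono i x : ℂ)

lemma aestronglyMeasurable_resonance (hV : Admissible V) (f : L2) (c : Fin 3 → ℂ) :
    AEStronglyMeasurable (resonance V f c) := by
  refine (aestronglyMeasurable_convG (aestronglyMeasurable_density hV f)).sub
    (Continuous.aestronglyMeasurable ?_)
  exact continuous_finsetSum _ fun i _ => continuous_const.mul
    (Complex.continuous_ofReal.comp (continuous_mono i))

lemma rt_mul_resonance_ae (hV : Admissible V) {f : L2} {c : Fin 3 → ℂ}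
    (h : opT hV f = ∑ i, c i • monoV hV i) :
    ∀ᵐ x, (rt V x : ℂ) * resonance V f c x = -((sgn V x : ℂ) * f x) := by
  filter_upwards [opT_ae hV f, sum_monoV_ae hV c] with x h1 h2
  rw [← h, h1] at h2
  rw [resonance, mul_sub, ← h2]
  ring

lemma mul_resonance_ae (hV : Admissible V) {f : L2} {c : Fin 3 → ℂ}
    (h : opT hV f = ∑ i, c i • monoV hV i) :
    ∀ᵐ x, (V x : ℂ) * resonance V f c x = -density V f x := by
  filter_upwards [rt_mul_resonance_ae hV h] with x hx
  have h1 : ((sgn V x : ℝ) : ℂ) * (sgn V x : ℂ) = 1 := by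
    rw [← Complex.ofReal_mul, sgn_mul_self, Complex.ofReal_one]
  rw [← sgn_mul_rt_sq (V := V) x, density]
  push_cast
  linear_combination (sgn V x : ℂ) * (rt V x : ℂ) * hx - (rt V x : ℂ) * f x * h1

/-- Functions in the kernel of `S₀ T₀ S₀` produce resonances: the moment conditions give linear
growth, and `Δ² G_{2,l} (v f) = v f = -V φ`. -/
lemma mk_resonance_mem (hV : Admissible V) {f : L2} (hf : f ∈ S0 hV) {c : Fin 3 → ℂ}
    (h : opT hV f = ∑ i, c i • monoV hV i) :
    AEEqFun.mk (resonance V f c) (aestronglyMeasurable_resonance hV f c) ∈ resonanceSpace V := by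
  have hco := AEEqFun.coeFn_mk (resonance V f c) (aestronglyMeasurable_resonance hV f c)
  have hmom : ∀ i, ∫ y, (mono i y : ℂ) * density V f y = 0 := fun i => by
    rw [← inner_monoV hV]
    exact (mem_S0_iff hV f).1 hf i
  obtain ⟨C, hC⟩ := exists_norm_convG_le (integrable_density hV f)
    (aestronglyMeasurable_density hV f) hmom
  have hi3 := integrable_density_three hV f
  have hint := integrable_of_weighted hi3
  refine ⟨⟨C + 2 * ∑ i, ‖c i‖, ?_⟩, ?_, fun ψ hψ hψc => ?_⟩
  · filter_upwards [hco] with x hx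
    rw [hx, resonance, add_mul]
    refine (norm_sub_le _ _).trans (add_le_add (hC x) ?_)
    refine (norm_sum_le _ _).trans ?_
    rw [Finset.mul_sum, Finset.sum_mul]
    refine Finset.sum_le_sum fun i _ => ?_
    rw [norm_mul, Complex.norm_real, Real.norm_eq_abs]
    have := (abs_mono_le i x).trans (one_add_norm_le x)
    nlinarith [norm_nonneg (c i)]
  · refine hint.neg.locallyIntegrable.congr ?_
    filter_upwards [hco, mul_resonance_ae hV h] with x h1 h2
    rw [h1, h2, Pi.neg_apply]
  · have cL := (contDiff_lap (contDiff_lap hψ)).continuous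
    have sL := hasCompactSupport_lap (hasCompactSupport_lap hψc)
    have e1 : ∫ x, AEEqFun.mk (resonance V f c) (aestronglyMeasurable_resonance hV f c) x *
        Laplacian.laplacian (Laplacian.laplacian ψ) x = ∫ x, density V f x * ψ x := by
      have i1 : Integrable (fun x => convG (density V f) x *
          Laplacian.laplacian (Laplacian.laplacian ψ) x) :=
        (locallyIntegrable_convG hi3).integrable_smul_right_of_hasCompactSupport cL sL
      have i2 : ∀ i, Integrable (fun x => c i * ((mono i x : ℂ) *
          Laplacian.laplacian (Laplacian.laplacian ψ) x)) := fun i =>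
        (((contDiff_mono i).continuous.mul cL).integrable_of_hasCompactSupport
          sL.mul_left).const_mul _
      have e : ∫ x, AEEqFun.mk (resonance V f c) (aestronglyMeasurable_resonance hV f c) x *
          Laplacian.laplacian (Laplacian.laplacian ψ) x =
          ∫ x, (convG (density V f) x * Laplacian.laplacian (Laplacian.laplacian ψ) x -
            ∑ i, c i * ((mono i x : ℂ) * Laplacian.laplacian (Laplacian.laplacian ψ) x)) := by
        refine integral_congr_ae ?_
        filter_upwards [hco] with x hx
        rw [hx, resonance, sub_mul, Finset.sum_mul]
        simp only [mul_assoc]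
      rw [e, integral_sub i1 (integrable_finsetSum _ fun i _ => i2 i),
        integral_finsetSum _ fun i _ => i2 i, integral_convG_mul_bilaplacian hi3 hψ hψc]
      simp [integral_const_mul, integral_mono_mul_bilaplacian _ hψ hψc]
    have e2 : ∫ x, (V x : ℂ) * AEEqFun.mk (resonance V f c)
        (aestronglyMeasurable_resonance hV f c) x * ψ x = -∫ x, density V f x * ψ x := by
      rw [← integral_neg]
      refine integral_congr_ae ?_
      filter_upwards [hco, mul_resonance_ae hV h] with x h1 h2
      rw [h1, h2, neg_mul]
    rw [e1, e2, add_neg_cancel]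

/-! ### From resonances to the kernel of `S₀ T₀ S₀` -/

lemma memLp_sgn_rt_mul (hV : Admissible V) (φ : resonanceSpace V) :
    MemLp (fun x => -((sgn V x : ℂ) * ((rt V x : ℂ) * (φ : Plane →ₘ[volume] ℂ) x))) 2 volume := by
  obtain ⟨C, hC⟩ := φ.2.1
  refine hV.memLp_wt.of_le_mul (c := |C|) ?_ ?_
  · exact ((Complex.continuous_ofReal.comp_aestronglyMeasurable hV.aesm_sgn).mul
      ((Complex.continuous_ofReal.comp_aestronglyMeasurable hV.aesm_rt).mul
        (φ : Plane →ₘ[volume] ℂ).aestronglyMeasurable)).neg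
  · filter_upwards [hC] with x hx
    have h1 : ‖sgn V x‖ = 1 := by
      unfold sgn
      split_ifs <;> simp
    rw [norm_neg, norm_mul, norm_mul, Complex.norm_real, Complex.norm_real, h1, one_mul,
      Real.norm_of_nonneg (rt_nonneg x), Real.norm_of_nonneg (wt_nonneg x), wt]
    have h2 : jap x ≤ (1 + ‖x‖) ^ 3 :=
      (jap_le x).trans (le_self_pow₀ (by linarith [norm_nonneg x]) (by norm_num))
    have h3 := one_le_jap x
    have h4 : ‖(φ : Plane →ₘ[volume] ℂ) x‖ ≤ |C| * (1 + ‖x‖) ^ 3 :=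
      hx.trans (mul_le_mul (le_abs_self C) h2 (by linarith) (abs_nonneg C))
    calc rt V x * ‖(φ : Plane →ₘ[volume] ℂ) x‖ ≤ rt V x * (|C| * (1 + ‖x‖) ^ 3) :=
          mul_le_mul_of_nonneg_left h4 (rt_nonneg x)
      _ = _ := by ring

/-- The map `φ ↦ -U v φ` from resonances to `L²`. -/
noncomputable def resonanceToL2 (hV : Admissible V) : resonanceSpace V →ₗ[ℂ] L2 where
  toFun φ := (memLp_sgn_rt_mul hV φ).toLp _
  map_add' := by
    intro φ χ
    refine Lp.ext ?_
    filter_upwards [(memLp_sgn_rt_mul hV (φ + χ)).coeFn_toLp, (memLp_sgn_rt_mul hV φ).coeFn_toLp,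
      (memLp_sgn_rt_mul hV χ).coeFn_toLp, AEEqFun.coeFn_add (φ : Plane →ₘ[volume] ℂ) χ,
      Lp.coeFn_add ((memLp_sgn_rt_mul hV φ).toLp _) ((memLp_sgn_rt_mul hV χ).toLp _)]
      with x h1 h2 h3 h4 h5
    rw [h5, Pi.add_apply, h1, h2, h3, Submodule.coe_add, h4, Pi.add_apply]
    ring
  map_smul' := by
    intro c φ
    refine Lp.ext ?_
    filter_upwards [(memLp_sgn_rt_mul hV (c • φ)).coeFn_toLp, (memLp_sgn_rt_mul hV φ).coeFn_toLp,
      AEEqFun.coeFn_smul c (φ : Plane →ₘ[volume] ℂ),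
      Lp.coeFn_smul c ((memLp_sgn_rt_mul hV φ).toLp _)] with x h1 h2 h4 h5
    rw [RingHom.id_apply, h5, Pi.smul_apply, h1, h2, Submodule.coe_smul, h4, Pi.smul_apply,
      smul_eq_mul, smul_eq_mul]
    ring

lemma resonanceToL2_ae (hV : Admissible V) (φ : resonanceSpace V) :
    resonanceToL2 hV φ =ᵐ[volume]
      fun x => -((sgn V x : ℂ) * ((rt V x : ℂ) * (φ : Plane →ₘ[volume] ℂ) x)) :=
  (memLp_sgn_rt_mul hV φ).coeFn_toLp

/-- The structure of a resonance `φ`: with `f = -U v φ`, the Liouville type theorem represents `φ`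
as `G_{2,l} (v f)` minus an affine function, and the linear growth of `φ` forces the moments of
`v f` of order at most one to vanish. -/
lemma exists_resonance_representation (hV : Admissible V) (φ : resonanceSpace V) :
    resonanceToL2 hV φ ∈ S0 hV ∧ ∃ c : Fin 3 → ℂ,
      opT hV (resonanceToL2 hV φ) = ∑ i, c i • monoV hV i ∧
      (φ : Plane →ₘ[volume] ℂ) =ᵐ[volume] resonance V (resonanceToL2 hV φ) c := by
  set f := resonanceToL2 hV φ with hf
  have hfae := resonanceToL2_ae hV φ
  obtain ⟨C, hC⟩ := φ.2.1
  have hd : ∀ᵐ x, density V f x = -((V x : ℂ) * (φ : Plane →ₘ[volume] ℂ) x) := by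
    filter_upwards [hfae] with x hx
    rw [density, hx, ← sgn_mul_rt_sq (V := V) x]
    push_cast
    ring
  obtain ⟨c, hc⟩ := exists_ae_eq_convG_add (φ : Plane →ₘ[volume] ℂ).aestronglyMeasurable hC
    (integrable_density_three hV f) fun ψ hψ hψc => by
      rw [eq_neg_of_add_eq_zero_left (φ.2.2.2 ψ hψ hψc), ← integral_neg]
      refine integral_congr_ae ?_
      filter_upwards [hd] with x hx
      rw [hx]
      ring
  have hbound : ∀ᵐ x : Plane, ‖convG (density V f) x + ∑ i, c i * (mono i x : ℂ)‖ ≤ C * jap x := by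
    filter_upwards [hC, hc] with x h1 h2
    rwa [← h2]
  refine ⟨(mem_S0_iff hV f).2 fun i => ?_, -c, ?_, ?_⟩
  · rw [inner_monoV]
    exact integral_mono_mul_eq_zero (integrable_density hV f)
      (aestronglyMeasurable_density hV f) hbound i
  · refine Lp.ext ?_
    filter_upwards [opT_ae hV f, sum_monoV_ae hV (-c), hfae, hc] with x h1 h2 h3 h4
    have h5 : ((sgn V x : ℝ) : ℂ) * (sgn V x : ℂ) = 1 := by
      rw [← Complex.ofReal_mul, sgn_mul_self, Complex.ofReal_one]
    rw [h1, h2, h3, h4]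
    simp only [Pi.neg_apply, neg_mul, Finset.sum_neg_distrib]
    linear_combination (-(rt V x : ℂ) * (convG (density V f) x +
      ∑ i, c i * (mono i x : ℂ))) * h5
  · filter_upwards [hc] with x hx
    rw [hx, resonance]
    simp

lemma compT_eq_zero_iff (hV : Admissible V) (f : S0 hV) :
    compT hV f = 0 ↔ ∃ c : Fin 3 → ℂ, opT hV f = ∑ i, c i • monoV hV i := by
  have h1 : compT hV f = 0 ↔ (S0 hV).starProjection (opT hV f) = 0 := by
    rw [← coe_compT, Submodule.coe_eq_zero]
  rw [h1, Submodule.starProjection_apply_eq_zero_iff,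
    show (S0 hV)ᗮ = Submodule.span ℂ (Set.range (monoV hV)) from
      Submodule.orthogonal_orthogonal _,
    Submodule.mem_span_range_iff_exists_fun]
  exact exists_congr fun c => eq_comm

/-- The map `φ ↦ -U v φ` from resonances to the kernel of `S₀ T₀ S₀`. -/
noncomputable def resonanceToKer (hV : Admissible V) :
    resonanceSpace V →ₗ[ℂ] LinearMap.ker (compT hV).toLinearMap :=
  LinearMap.codRestrict _
    (LinearMap.codRestrict (S0 hV) (resonanceToL2 hV)
      fun φ => (exists_resonance_representation hV φ).1)
    fun φ => (compT_eq_zero_iff hV _).2 <| by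
      obtain ⟨_, c, h, _⟩ := exists_resonance_representation hV φ
      exact ⟨c, h⟩

lemma coe_resonanceToKer (hV : Admissible V) (φ : resonanceSpace V) :
    ((resonanceToKer hV φ : S0 hV) : L2) = resonanceToL2 hV φ := rfl

lemma resonanceToKer_mk (hV : Admissible V) (f : LinearMap.ker (compT hV).toLinearMap)
    {c : Fin 3 → ℂ} (h : opT hV (f : S0 hV) = ∑ i, c i • monoV hV i) :
    resonanceToKer hV ⟨_, mk_resonance_mem hV (f : S0 hV).2 h⟩ = f := by
  refine Subtype.ext (Subtype.ext (Lp.ext ?_))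
  rw [coe_resonanceToKer]
  filter_upwards [resonanceToL2_ae hV ⟨_, mk_resonance_mem hV (f : S0 hV).2 h⟩,
    AEEqFun.coeFn_mk (resonance V ((f : S0 hV) : L2) c)
      (aestronglyMeasurable_resonance hV ((f : S0 hV) : L2) c),
    rt_mul_resonance_ae hV h] with x h1 h2 h3
  rw [h1, h2, h3, mul_neg, neg_neg, ← mul_assoc, ← Complex.ofReal_mul, sgn_mul_self,
    Complex.ofReal_one, one_mul]

lemma exists_opT_eq (hV : Admissible V) (f : LinearMap.ker (compT hV).toLinearMap) :
    ∃ c : Fin 3 → ℂ, opT hV (f : S0 hV) = ∑ i, c i • monoV hV i :=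
  (compT_eq_zero_iff hV f).1 f.2

lemma bijective_resonanceToKer (hV : Admissible V) (hV0 : ¬ V =ᵐ[volume] 0) :
    Function.Bijective (resonanceToKer hV) := by
  constructor
  · refine (injective_iff_map_eq_zero _).2 fun φ hφ => ?_
    obtain ⟨-, c, hc, hrep⟩ := exists_resonance_representation hV φ
    have hf : resonanceToL2 hV φ = 0 := by
      rw [← coe_resonanceToKer, hφ]
      rfl
    rw [hf] at hc hrep
    have hc0 : c = 0 := eq_zero_of_sum_monoV_eq_zero hV hV0 (by rw [← hc, map_zero])
    refine Subtype.ext (AEEqFun.ext ?_)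
    have hconv : ∀ x, convG (density V ((0 : L2) : Plane → ℂ)) x = 0 := fun x => by
      simp [convG, density]
    filter_upwards [hrep, AEEqFun.coeFn_zero (α := Plane) (β := ℂ) (μ := volume)] with x h1 h2
    rw [h1, Submodule.coe_zero, h2, resonance, hconv, hc0]
    simp
  · intro f
    obtain ⟨c, hc⟩ := exists_opT_eq hV f
    exact ⟨_, resonanceToKer_mk hV f hc⟩

/-- The isomorphism between resonances and the kernel of `S₀ T₀ S₀` given by `φ ↦ -U v φ`. -/
noncomputable def resonanceEquiv (hV : Admissible V) (hV0 : ¬ V =ᵐ[volume] 0) :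
    resonanceSpace V ≃ₗ[ℂ] LinearMap.ker (compT hV).toLinearMap :=
  LinearEquiv.ofBijective (resonanceToKer hV) (bijective_resonanceToKer hV hV0)

end ZeroResonance

theorem mainTheorem5 (V : Plane → ℝ) (hV : Admissible V) (hV0 : ¬ V =ᵐ[volume] 0) :
    (IsRegularAtZero V ↔ IsUnit (compT hV)) ∧
    (¬ IsRegularAtZero V →
      (∀ f : LinearMap.ker (compT hV).toLinearMap,
        ∃! c : Fin 3 → ℂ, opT hV (f : S0 hV) = ∑ i, c i • monoV hV i) ∧
      ∃ Φ : LinearMap.ker (compT hV).toLinearMap ≃ₗ[ℂ] resonanceSpace V,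
        (∀ (f : LinearMap.ker (compT hV).toLinearMap) (c : Fin 3 → ℂ),
          opT hV (f : S0 hV) = ∑ i, c i • monoV hV i →
            (Φ f : Plane →ₘ[volume] ℂ) =ᵐ[volume] fun x : Plane =>
              convG (fun y => (rt V y : ℂ) * ((f : S0 hV) : L2) y) x
                - ∑ i, c i * (mono i x : ℂ)) ∧
        (∀ φ : resonanceSpace V,
          (((Φ.symm φ : S0 hV) : L2) : Plane → ℂ) =ᵐ[volume] fun x : Plane =>
            -((sgn V x : ℂ) * ((rt V x : ℂ) * (φ : Plane →ₘ[volume] ℂ) x)))) := by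
  refine ⟨?_, fun _ => ⟨fun f => ?_, (resonanceEquiv hV hV0).symm, fun f c h => ?_, fun φ => ?_⟩⟩
  · rw [isUnit_compT_iff, IsRegularAtZero, ← Submodule.subsingleton_iff_eq_bot,
      ← Submodule.subsingleton_iff_eq_bot]
    exact (resonanceEquiv hV hV0).toEquiv.subsingleton_congr
  · obtain ⟨c, hc⟩ := exists_opT_eq hV f
    refine ⟨c, hc, fun d hd => ?_⟩
    refine sub_eq_zero.1 (eq_zero_of_sum_monoV_eq_zero hV hV0 ?_)
    simp only [Pi.sub_apply, sub_smul, Finset.sum_sub_distrib]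
    rw [← hd, ← hc, sub_self]
  · have h1 : (resonanceEquiv hV hV0).symm f = ⟨_, mk_resonance_mem hV (f : S0 hV).2 h⟩ :=
      (LinearEquiv.symm_apply_eq _).2 (resonanceToKer_mk hV f h).symm
    rw [h1]
    exact AEEqFun.coeFn_mk _ _
  · exact resonanceToL2_ae hV φ
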